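/- Let $N\ge 0$ be an integer and let $J:\mathbb R^N\times\mathbb R^N\to[0,\infty)$ be a measurable kernel with $J(x,y)=J(y,x)$ for $x\neq y$ and $\sup_{x}\int_{\mathbb R^N} J(x,y)\min\{1,|x-y|^2\}\,dy<\infty$. Put $$\mathcal E(f,g)=\tfrac12\int_{\mathbb R^N}\!\int_{\mathbb R^N}(f(x)-f(y))(g(x)-g(y))J(x,y)\,dx\,dy,\qquad H_{\mathcal L}=\{f\in L^2(\mathbb R^N):\mathcal E(f,f)<\infty\},$$ with norm $\|f\|_2+\mathcal E(f,f)^{1/2}$, and let $\mathcal L$ be the operator given by $\langle\mathcal Lf,g\rangle=\mathcal E(f,g)$ for $f,g\in H_{\mathcal L}$. All functions are real valued. A mild solution of $\partial_tu+\mathcal Lu=0$ is a function $u\in C([0,\infty);L^2)\cap C^1((0,\infty);L^2)\cap C((0,\infty);H_{\mathcal L})$ with $\langle u'(t),g\rangle+\mathcal E(u(t),g)=0$ for all $t>0$ and $g\in H_{\mathcal L}$. For $u_0\in L^p$, a solution with initial datum $u_0$ is a function $u$ such that there are mild solutions $v_n$ with $v_n(0)\in L^2\cap L^p$, $v_n(0)\to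 u_0$ in $L^p$, and $v_n(t)\to u(t)$ in $L^p$ for every $t\ge0$ (this includes the mild solutions with $u_0\in L^2\cap L^p$). Write $\mathrm{Ent}(g)=\int\Phi(|g|)-\Phi\big(\int|g|\big)$ with $\Phi(s)=s\log s$ (extended-real valued, $g$ integrable). For $r\ge2$, the $r$-logarithmic Sobolev inequality with constants $C(r)\in\mathbb R$ and $D(r)>0$ is $$\mathrm{Ent}(|f|^r)\le C(r)\|f\|_r^r+D(r)\,\mathcal E(|f|^{r-2}f,f)\qquad\text{for every measurable } f \text{ with } |f|^{r/2}\in H_{\mathcal L}.$$ **Theorem.** Fix $p\ge2$ and suppose that the $r$-logarithmic Sobolev inequality holds for every $r\ge p$ with constants $C(r)$, $D(r)>0$, where $D$ is continuous and $C$ is locally integrable on $[p,\infty)$. Then: 1. There are $t_\infty\in(0,\infty]$ and $q:[0,t_\infty)\to[p,\infty)$ with $$q'(t)=\frac{q(t)^2}{D(q(t))},\qquad q(0)=p,\qquad \lim_{t\to t_\infty}q(t)=\infty .$$ 2. For every such $t_\infty$ and $q$, $\mathcal L$ is $p$-hypercontractive with exponents $q$ and coefficients $A_p$: the function $q$ is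 nondecreasing and $$\|u(t)\|_{q(t)}\le A_p(t)\,\|u_0\|_p\qquad\text{for all } 0<t<t_\infty,$$ for every $u_0\in L^p(\mathbb R^N)$ and every solution $u$ with initial datum $u_0$, where $$A_p(t)=\exp\Big(\int_0^t\frac{C(q(s))}{D(q(s))}\,ds\Big)=\exp\Big(\int_p^{q(t)}\frac{C(\alpha)}{\alpha^2}\,d\alpha\Big),$$ both integrals being absolutely convergent for $0\le t<t_\infty$. -/

import Mathlib

open MeasureTheory Set Filter Topology
open scoped ENNReal NNReal

noncomputable section

namespace LevyHyper

/-- Euclidean space of dimension `N`, carrying the Euclidean norm and Lebesgue measure. -/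
abbrev Space (N : ℕ) : Type := EuclideanSpace ℝ (Fin N)

/-- The extended-real integral of a real function, positive part minus negative part. It is the
Bochner integral for integrable functions and is `+∞` or `-∞` when exactly one of the two parts
has infinite integral. -/
def extIntegral {α : Type*} [MeasurableSpace α] (μ : Measure α) (h : α → ℝ) : EReal :=
  ((∫⁻ x, ENNReal.ofReal (h x) ∂μ : ℝ≥0∞) : EReal)
    - ((∫⁻ x, ENNReal.ofReal (-h x) ∂μ : ℝ≥0∞) : EReal)

/-- Symmetric Lévy kernels: measurable, nonnegative (built into the codomain), symmetric off the
diagonal, with `sup_x ∫ J(x,y) min(1, |x-y|²) dy < ∞`. Diagonal values play no role. -/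
structure IsLevyKernel {N : ℕ} (J : Space N → Space N → ℝ≥0) : Prop where
  measurable : Measurable (Function.uncurry J)
  symm : ∀ x y, x ≠ y → J x y = J y x
  levy : (⨆ x, ∫⁻ y, (J x y : ℝ≥0∞) * ENNReal.ofReal (min 1 (‖x - y‖ ^ 2))) < ⊤

/-- The Dirichlet form `E(f,g) = ½ ∬ (f(x)-f(y)) (g(x)-g(y)) J(x,y) dx dy`. -/
def dirichletForm {N : ℕ} (J : Space N → Space N → ℝ≥0) (f g : Space N → ℝ) : EReal :=
  extIntegral (volume : Measure (Space N × Space N))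
    (fun z => 1 / 2 * ((f z.1 - f z.2) * (g z.1 - g z.2) * (J z.1 z.2 : ℝ)))

/-- Membership in `H_L`: square integrable functions of finite energy. -/
def MemEnergySpace {N : ℕ} (J : Space N → Space N → ℝ≥0) (f : Space N → ℝ) : Prop :=
  MemLp f 2 volume ∧ dirichletForm J f f < ⊤

/-- Mild solutions of `∂ₜu + Lu = 0` (the initial datum is `u 0`):
`u ∈ C([0,∞); L²) ∩ C¹((0,∞); L²) ∩ C((0,∞); H_L)` and the abstract equation holds for every
`t > 0`, where `L` is given by `⟨L f, g⟩ = E(f,g)` for `f, g ∈ H_L`. -/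
structure IsMildSolution {N : ℕ} (J : Space N → Space N → ℝ≥0)
    (u : ℝ → Lp ℝ 2 (volume : Measure (Space N))) : Prop where
  continuousOn : ContinuousOn u (Ici 0)
  contDiffOn : ContDiffOn ℝ 1 u (Ioi 0)
  memEnergySpace : ∀ t, 0 < t → MemEnergySpace J (u t)
  energy_continuous : ∀ t, 0 < t →
    Tendsto (fun s => dirichletForm J (fun x => u s x - u t x) (fun x => u s x - u t x))
      (𝓝 t) (𝓝 0)
  equation : ∀ t, 0 < t → ∀ g : Lp ℝ 2 (volume : Measure (Space N)), MemEnergySpace J g →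
    ((inner ℝ (deriv u t) g : ℝ) : EReal) + dirichletForm J (u t) g = 0

/-- Solutions with initial datum `u₀ ∈ L^p`: for every `t ≥ 0`, `u t` is the `L^p`-limit of the
values at time `t` of mild solutions whose initial data lie in `L² ∩ L^p` and converge to `u₀`
in `L^p`. A mild solution with datum in `L² ∩ L^p` is one (take a constant sequence). -/
def IsSolution {N : ℕ} (J : Space N → Space N → ℝ≥0) (p : ℝ)
    (u₀ : Space N → ℝ) (u : ℝ → Space N → ℝ) : Prop :=
  MemLp u₀ (ENNReal.ofReal p) volume ∧
  (∀ t, 0 ≤ t → AEStronglyMeasurable (u t) volume) ∧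
  ∃ v : ℕ → ℝ → Lp ℝ 2 (volume : Measure (Space N)),
    (∀ n, IsMildSolution J (v n)) ∧
    (∀ n, MemLp (v n 0) (ENNReal.ofReal p) volume) ∧
    Tendsto (fun n => eLpNorm (fun x => v n 0 x - u₀ x) (ENNReal.ofReal p) volume)
      atTop (𝓝 0) ∧
    ∀ t, 0 ≤ t →
      Tendsto (fun n => eLpNorm (fun x => v n t x - u t x) (ENNReal.ofReal p) volume)
        atTop (𝓝 0)

/-- The entropy `Ent(f) = ∫ Φ(|f|) - Φ(∫ |f|)` with `Φ(s) = s log s`, for integrable `f`. The first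
integral may be infinite. -/
def entropy {N : ℕ} (f : Space N → ℝ) : EReal :=
  extIntegral (volume : Measure (Space N)) (fun x => |f x| * Real.log |f x|)
    - (((∫ x, |f x|) * Real.log (∫ x, |f x|) : ℝ) : EReal)

/-- The `r`-logarithmic Sobolev inequality with constants `C` and `D > 0`:
`Ent(|f|^r) ≤ C ‖f‖_r^r + D E(|f|^(r-2) f, f)` whenever `|f|^(r/2) ∈ H_L`. -/
def LogSobolev {N : ℕ} (J : Space N → Space N → ℝ≥0) (r C D : ℝ) : Prop :=
  0 < D ∧ ∀ f : Space N → ℝ, AEStronglyMeasurable f volume →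
    MemEnergySpace J (fun x => |f x| ^ (r / 2)) →
    entropy (fun x => |f x| ^ r) ≤
      ((C * ∫ x, |f x| ^ r : ℝ) : EReal)
        + (D : EReal) * dirichletForm J (fun x => |f x| ^ (r - 2) * f x) f

/-- The interval `[0, T)` for `T ∈ (0, ∞]`. -/
def timeInterval (T : EReal) : Set ℝ := {t : ℝ | 0 ≤ t ∧ (t : EReal) < T}

/-- A function `q : [0, T) → [p, ∞)` solving `q' = q² / D(q)`, `q(0) = p` (one-sided derivative at
`0`), and tending to `∞` at `T`. -/
structure IsExponent (D : ℝ → ℝ) (p : ℝ) (T : EReal) (q : ℝ → ℝ) : Prop where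
  pos : 0 < T
  initial : q 0 = p
  le : ∀ t ∈ timeInterval T, p ≤ q t
  ode : ∀ t ∈ timeInterval T, HasDerivWithinAt q (q t ^ 2 / D (q t)) (timeInterval T) t
  tendsto : Tendsto q (comap ((↑) : ℝ → EReal) (𝓝[<] T)) atTop

/-- `p`-hypercontractivity with exponents `q : [0, T) → [p, ∞)` and coefficients `A`:
`q` is nondecreasing, `q(0) = p`, `q(t) → ∞` as `t → T`, `A ≥ 0`, and
`‖u(t)‖_{q(t)} ≤ A(t) ‖u₀‖_p` for `0 < t < T` and all initial data `u₀ ∈ L^p`. -/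
structure Hypercontractive {N : ℕ} (J : Space N → Space N → ℝ≥0) (p : ℝ) (T : EReal)
    (q A : ℝ → ℝ) : Prop where
  pos : 0 < T
  monotoneOn : MonotoneOn q (timeInterval T)
  le : ∀ t ∈ timeInterval T, p ≤ q t
  initial : q 0 = p
  tendsto : Tendsto q (comap ((↑) : ℝ → EReal) (𝓝[<] T)) atTop
  nonneg : ∀ t ∈ timeInterval T, 0 ≤ A t
  bound : ∀ (u₀ : Space N → ℝ) (u : ℝ → Space N → ℝ), IsSolution J p u₀ u →
    ∀ t : ℝ, 0 < t → (t : EReal) < T →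
      eLpNorm (u t) (ENNReal.ofReal (q t)) volume
        ≤ ENNReal.ofReal (A t) * eLpNorm u₀ (ENNReal.ofReal p) volume

end LevyHyper

end

noncomputable section

namespace LevyHyper

variable {N : ℕ} {J : Space N → Space N → ℝ≥0}

/-! The estimate is Gross's argument. Formally put y(t) = ∫|u(t)|^{q(t)} and differentiate log y /
q. Since u' = -Lu and q'/q² = 1/D(q), the derivative equals (1/(D y)) (Ent(|u|^q) - D E(|u|^{q-2}u,
u)), which the logarithmic Sobolev inequality bounds by C(q)/D(q). Integrating in time gives the
coefficient, and the substitution α = q(s) gives its second form.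

A mild solution need not be bounded, and its powers need not lie in the form domain, so the
derivative cannot be taken on u itself. The argument therefore runs on the implicit Euler scheme.
One step is a resolvent (`exists_isResolvent`), which maps L² into the form domain, preserves bounds
(`IsResolvent.ae_abs_le`) and contracts L². Between consecutive values f and w the scheme is
interpolated linearly. Monotonicity of |s|^{r-2}s bounds the dissipation by the energy at w
(`IsResolvent.integral_interp_le`), and the logarithmic Sobolev inequality is applied at w. Passing
from w back to the interpolant costs O(h), because a start at a value that is itself a resolvent
keeps all increments of order h in L² (`IsEulerChain.integral_first_sub_sq_le`). This gives Gross's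
differential inequality with a small error (`IsExponentCurve.exists_step_growth`), valid only where
y stays above a positive threshold. The comparison principle `le_exp_of_log_growth` suffices because
the bound to be propagated lies above that threshold, and `IsExponentCurve.euler_bound` iterates it.

The scheme converges in L² to the mild solution on [a,b] with a > 0
(`IsMildSolution.euler_converges`). Starting at a small positive time also makes q(a) > 2 when p =
2. Resolvents of truncated data supply the starting value, with its L^p norm under control
(`IsResolvent.integral_rpow_le`). Fatou's lemma along a.e. convergent subsequences then carries the
bound to mild solutions and to their L^p limits. The exponent function itself comes from separation
of variables (`exists_isExponent`). -/

/-! ### The jump measure and the form domain -/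

/-- The measure `½ J(x,y) dx dy` on pairs of points. -/
def jumpMeasure (J : Space N → Space N → ℝ≥0) : Measure (Space N × Space N) :=
  volume.withDensity (fun z => ((J z.1 z.2 / 2 : ℝ≥0) : ℝ≥0∞))

/-- The difference `f(x) - f(y)` as a function of the pair `(x, y)`. -/
def diff (f : Space N → ℝ) : Space N × Space N → ℝ := fun z => f z.1 - f z.2

/-- The Dirichlet form as a real Bochner integral. -/
def energy (J : Space N → Space N → ℝ≥0) (f g : Space N → ℝ) : ℝ :=
  ∫ z, diff f z * diff g z ∂jumpMeasure J

lemma jumpMeasure_absolutelyContinuous : jumpMeasure J ≪ volume :=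
  withDensity_absolutelyContinuous _ _

lemma measurable_density (hJ : IsLevyKernel J) :
    Measurable (fun z : Space N × Space N => (J z.1 z.2 / 2 : ℝ≥0)) :=
  hJ.measurable.div_const 2

lemma integrable_jumpMeasure_iff (hJ : IsLevyKernel J) {g : Space N × Space N → ℝ} :
    Integrable g (jumpMeasure J) ↔ Integrable (fun z => 1 / 2 * (g z * (J z.1 z.2 : ℝ))) volume := by
  rw [jumpMeasure, integrable_withDensity_iff_integrable_smul (measurable_density hJ)]
  refine iff_of_eq (congrArg (fun F => Integrable F volume) ?_)
  funext z
  simp only [NNReal.smul_def, smul_eq_mul, NNReal.coe_div, NNReal.coe_ofNat]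
  ring

lemma integral_jumpMeasure (hJ : IsLevyKernel J) (g : Space N × Space N → ℝ) :
    ∫ z, g z ∂jumpMeasure J = ∫ z, 1 / 2 * (g z * (J z.1 z.2 : ℝ)) := by
  rw [jumpMeasure, integral_withDensity_eq_integral_smul (measurable_density hJ)]
  congr 1
  funext z
  simp only [NNReal.smul_def, smul_eq_mul, NNReal.coe_div, NNReal.coe_ofNat]
  ring

lemma extIntegral_eq_integral {α : Type*} [MeasurableSpace α] {μ : Measure α} {h : α → ℝ}
    (hh : Integrable h μ) : extIntegral μ h = ((∫ x, h x ∂μ : ℝ) : EReal) := by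
  have h1 : ∫⁻ x, ENNReal.ofReal (h x) ∂μ ≠ ⊤ := hh.lintegral_lt_top.ne
  have h2 : ∫⁻ x, ENNReal.ofReal (-h x) ∂μ ≠ ⊤ := hh.neg.lintegral_lt_top.ne
  rw [extIntegral, integral_eq_lintegral_pos_part_sub_lintegral_neg_part hh, EReal.coe_sub,
    EReal.coe_ennreal_toReal h1, EReal.coe_ennreal_toReal h2]

lemma ae_fst_of_ae {P : Space N → Prop} (h : ∀ᵐ x, P x) :
    ∀ᵐ z : Space N × Space N, P z.1 := by
  rw [Measure.volume_eq_prod]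
  exact Measure.quasiMeasurePreserving_fst.ae h

lemma ae_snd_of_ae {P : Space N → Prop} (h : ∀ᵐ x, P x) :
    ∀ᵐ z : Space N × Space N, P z.2 := by
  rw [Measure.volume_eq_prod]
  exact Measure.quasiMeasurePreserving_snd.ae h

lemma diff_congr {f g : Space N → ℝ} (h : f =ᵐ[volume] g) : diff f =ᵐ[volume] diff g := by
  filter_upwards [ae_fst_of_ae h, ae_snd_of_ae h] with z h1 h2
  simp only [diff, h1, h2]

lemma diff_congr_jump {f g : Space N → ℝ} (h : f =ᵐ[volume] g) :
    diff f =ᵐ[jumpMeasure J] diff g :=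
  jumpMeasure_absolutelyContinuous.ae_eq (diff_congr h)

lemma aestronglyMeasurable_diff {f : Space N → ℝ} (hf : AEStronglyMeasurable f volume) :
    AEStronglyMeasurable (diff f) (volume : Measure (Space N × Space N)) := by
  rw [Measure.volume_eq_prod]
  exact hf.comp_fst.sub hf.comp_snd

lemma aestronglyMeasurable_diff_jump {f : Space N → ℝ} (hf : AEStronglyMeasurable f volume) :
    AEStronglyMeasurable (diff f) (jumpMeasure J) :=
  (aestronglyMeasurable_diff hf).mono_ac jumpMeasure_absolutelyContinuous

/-- The form domain, described by square integrability of the function and of its differences. -/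
def InForm (J : Space N → Space N → ℝ≥0) (f : Space N → ℝ) : Prop :=
  MemLp f 2 volume ∧ MemLp (diff f) 2 (jumpMeasure J)

/-- On the diagonal the integrand of the form is nonnegative, so the negative part of the extended
integral vanishes and finiteness is integrability. -/
lemma memEnergySpace_iff (hJ : IsLevyKernel J) {f : Space N → ℝ} :
    MemEnergySpace J f ↔ InForm J f := by
  refine and_congr_right fun hf => ?_
  have hm := aestronglyMeasurable_diff hf.1
  rw [memLp_two_iff_integrable_sq (aestronglyMeasurable_diff_jump hf.1),
    integrable_jumpMeasure_iff hJ]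
  have hnn : ∀ z : Space N × Space N, 0 ≤ 1 / 2 * (diff f z ^ 2 * (J z.1 z.2 : ℝ)) :=
    fun z => by positivity
  have hmeas : AEStronglyMeasurable
      (fun z : Space N × Space N => 1 / 2 * (diff f z ^ 2 * (J z.1 z.2 : ℝ))) volume :=
    ((hm.pow 2).mul (hJ.measurable.coe_nnreal_real.aestronglyMeasurable)).const_mul _
  have hfun : (fun z : Space N × Space N =>
      1 / 2 * ((f z.1 - f z.2) * (f z.1 - f z.2) * (J z.1 z.2 : ℝ)))
      = fun z => 1 / 2 * (diff f z ^ 2 * (J z.1 z.2 : ℝ)) := by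
    funext z; simp only [diff]; ring
  constructor
  · intro h
    refine ⟨hmeas, ?_⟩
    rw [hasFiniteIntegral_iff_ofReal (ae_of_all _ hnn)]
    rw [dirichletForm, hfun, extIntegral] at h
    have h0 : ∫⁻ z : Space N × Space N,
        ENNReal.ofReal (-(1 / 2 * (diff f z ^ 2 * (J z.1 z.2 : ℝ)))) = 0 := by
      simp only [fun z => ENNReal.ofReal_of_nonpos (neg_nonpos.2 (hnn z)), lintegral_zero]
    rw [h0, EReal.coe_ennreal_zero, sub_zero, ← EReal.coe_ennreal_top,
      EReal.coe_ennreal_lt_coe_ennreal_iff] at h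
    exact h
  · intro h
    rw [dirichletForm, hfun, extIntegral_eq_integral h]
    exact EReal.coe_lt_top _

lemma dirichletForm_eq (hJ : IsLevyKernel J) {f g : Space N → ℝ} (hf : InForm J f)
    (hg : InForm J g) : dirichletForm J f g = (energy J f g : EReal) := by
  have hi : Integrable (fun z => diff f z * diff g z) (jumpMeasure J) := hf.2.integrable_mul hg.2
  rw [energy, integral_jumpMeasure hJ]
  exact extIntegral_eq_integral ((integrable_jumpMeasure_iff hJ).1 hi)

lemma InForm.congr {f g : Space N → ℝ} (hf : InForm J f) (h : f =ᵐ[volume] g) : InForm J g :=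
  ⟨(memLp_congr_ae h).1 hf.1, (memLp_congr_ae (diff_congr_jump h)).1 hf.2⟩

lemma energy_congr {f f' g g' : Space N → ℝ} (hf : f =ᵐ[volume] f') (hg : g =ᵐ[volume] g') :
    energy J f g = energy J f' g' := by
  refine integral_congr_ae ?_
  filter_upwards [diff_congr_jump (J := J) hf, diff_congr_jump (J := J) hg] with z h1 h2
  rw [h1, h2]

lemma InForm.sub {f g : Space N → ℝ} (hf : InForm J f) (hg : InForm J g) :
    InForm J (fun x => f x - g x) := by
  refine ⟨hf.1.sub hg.1, ?_⟩
  have : diff (fun x => f x - g x) = diff f - diff g := by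
    funext z; simp only [diff, Pi.sub_apply]; ring
  rw [this]
  exact hf.2.sub hg.2

/-- Lipschitz maps fixing 0 contract both L² conditions up to the factor `K`. The Lipschitz bound is
asked only on a set `S` containing the values of `f`, so that powers of bounded functions are
covered. -/
lemma InForm.comp_of_abs_sub_le {f : Space N → ℝ} (hf : InForm J f) {ψ : ℝ → ℝ} {K : ℝ}
    (hψ : Measurable ψ) (h0 : ψ 0 = 0) {S : Set ℝ} (hS : ∀ x, f x ∈ S) (h0S : (0 : ℝ) ∈ S)
    (hK : ∀ a ∈ S, ∀ b ∈ S, |ψ a - ψ b| ≤ K * |a - b|) : InForm J (fun x => ψ (f x)) := by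
  have hm : AEStronglyMeasurable (fun x => ψ (f x)) volume :=
    (hψ.comp_aemeasurable hf.1.1.aemeasurable).aestronglyMeasurable
  constructor
  · refine hf.1.of_le_mul hm (c := K) (ae_of_all _ fun x => ?_)
    simpa [h0] using hK (f x) (hS x) 0 h0S
  · exact hf.2.of_le_mul (aestronglyMeasurable_diff_jump hm) (c := K)
      (ae_of_all _ fun z => hK _ (hS _) _ (hS _))

lemma InForm.integrable_energy {f g : Space N → ℝ} (hf : InForm J f) (hg : InForm J g) :
    Integrable (fun z => diff f z * diff g z) (jumpMeasure J) := hf.2.integrable_mul hg.2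

lemma energy_sub_left {f f' g : Space N → ℝ} (hf : InForm J f) (hf' : InForm J f')
    (hg : InForm J g) :
    energy J (fun x => f x - f' x) g = energy J f g - energy J f' g := by
  rw [energy, energy, energy, ← integral_sub (hf.integrable_energy hg) (hf'.integrable_energy hg)]
  congr 1; funext z; simp only [diff]; ring

lemma energy_sub_right {f g g' : Space N → ℝ} (hf : InForm J f) (hg : InForm J g)
    (hg' : InForm J g') :
    energy J f (fun x => g x - g' x) = energy J f g - energy J f g' := by
  rw [energy, energy, energy, ← integral_sub (hf.integrable_energy hg) (hf.integrable_energy hg')]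
  congr 1; funext z; simp only [diff]; ring

lemma energy_self_nonneg (f : Space N → ℝ) : 0 ≤ energy J f f :=
  integral_nonneg fun _ => mul_self_nonneg _

/-! ### Resolvents: existence, Markov property, contraction -/

/-- `w` solves `w + h L w = f` in the weak sense. -/
def IsResolvent (J : Space N → Space N → ℝ≥0) (h : ℝ) (f w : Space N → ℝ) : Prop :=
  InForm J w ∧ ∀ g, InForm J g → (∫ x, (w x - f x) * g x) + h * energy J w g = 0

/-- The closed graph of `f ↦ c (f(x) - f(y))` in `L² × L²(jumpMeasure)`. -/
def formGraph (J : Space N → Space N → ℝ≥0) (c : ℝ) :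
    Submodule ℝ (WithLp 2 (Lp ℝ 2 (volume : Measure (Space N)) × Lp ℝ 2 (jumpMeasure J))) where
  carrier := {P | (P.snd : Space N × Space N → ℝ) =ᵐ[jumpMeasure J] fun z => c * diff P.fst z}
  add_mem' := by
    intro P Q hP hQ
    simp only [mem_ofPred_eq, WithLp.add_fst, WithLp.add_snd] at *
    filter_upwards [hP, hQ, Lp.coeFn_add P.snd Q.snd,
      diff_congr_jump (J := J) (Lp.coeFn_add P.fst Q.fst)] with z h1 h2 h3 h4
    rw [h3, h4, Pi.add_apply, h1, h2]
    simp only [diff, Pi.add_apply]; ring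
  zero_mem' := by
    simp only [mem_ofPred_eq, WithLp.zero_fst, WithLp.zero_snd]
    filter_upwards [Lp.coeFn_zero ℝ 2 (jumpMeasure J),
      diff_congr_jump (J := J) (Lp.coeFn_zero ℝ 2 (volume : Measure (Space N)))] with z h1 h2
    rw [h1, h2]
    simp [diff]
  smul_mem' := by
    intro a P hP
    simp only [mem_ofPred_eq, WithLp.smul_fst, WithLp.smul_snd] at *
    filter_upwards [hP, Lp.coeFn_smul a P.snd,
      diff_congr_jump (J := J) (Lp.coeFn_smul a P.fst)] with z h1 h2 h3
    rw [h2, h3, Pi.smul_apply, h1]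
    simp only [diff, Pi.smul_apply, smul_eq_mul]; ring

/-- L² limits are a.e. limits along subsequences, and a null set of points yields a null set of
pairs for the jump measure, so the pointwise relation survives. The second subsequence is taken
inside the first so that both components converge together. -/
lemma isClosed_formGraph (c : ℝ) : IsClosed (formGraph J c : Set (WithLp 2 (Lp ℝ 2
    (volume : Measure (Space N)) × Lp ℝ 2 (jumpMeasure J)))) := by
  rw [← isSeqClosed_iff_isClosed]
  intro P Q hP hPQ
  have hc := (WithLp.prod_continuous_ofLp 2 (Lp ℝ 2 (volume : Measure (Space N)))
    (Lp ℝ 2 (jumpMeasure J))).continuousAt.tendsto.comp hPQ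
  have h1 : Tendsto (fun n => (P n).fst) atTop (𝓝 Q.fst) :=
    (continuous_fst.tendsto _).comp hc
  have h2 : Tendsto (fun n => (P n).snd) atTop (𝓝 Q.snd) :=
    (continuous_snd.tendsto _).comp hc
  obtain ⟨ns, hns, hae1⟩ := (tendstoInMeasure_of_tendsto_Lp h1).exists_seq_tendsto_ae
  obtain ⟨ms, hms, hae2⟩ := (tendstoInMeasure_of_tendsto_Lp
    (h2.comp hns.tendsto_atTop)).exists_seq_tendsto_ae
  have hP' : ∀ᵐ z ∂jumpMeasure J, ∀ n, (P n).snd z = c * diff (P n).fst z :=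
    ae_all_iff.2 fun n => hP n
  have hd1 := jumpMeasure_absolutelyContinuous (J := J) (ae_fst_of_ae hae1)
  have hd2 := jumpMeasure_absolutelyContinuous (J := J) (ae_snd_of_ae hae1)
  change (Q.snd : Space N × Space N → ℝ) =ᵐ[jumpMeasure J] fun z => c * diff Q.fst z
  filter_upwards [hP', hd1, hd2, hae2] with z hz h3 h4 h5
  refine tendsto_nhds_unique h5 ?_
  have h6 := ((h3.sub h4).const_mul c).comp hms.tendsto_atTop
  refine h6.congr fun n => ?_
  simpa [diff] using (hz (ns (ms n))).symm

/-- Existence of the resolvent, by orthogonal projection onto the graph. -/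
lemma exists_isResolvent {h : ℝ} (hh : 0 ≤ h) {f : Space N → ℝ} (hf : MemLp f 2 volume) (hh' : h ≠ 0) :
    ∃ w, IsResolvent J h f w := by
  have : (formGraph J (√h)).HasOrthogonalProjection := by
    have := (isClosed_formGraph (J := J) (√h)).completeSpace_coe
    infer_instance
  have hs : √h ≠ 0 := (Real.sqrt_ne_zero hh).2 hh'
  -- Projecting (f, 0) onto the pairs (w, √h·diff w) makes the residual (f - w, -√h·diff w)
  -- orthogonal to every (g, √h·diff g), which is the weak resolvent equation.
  set F : WithLp 2 (Lp ℝ 2 (volume : Measure (Space N)) × Lp ℝ 2 (jumpMeasure J)) :=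
    WithLp.toLp 2 (hf.toLp f, 0) with hF
  set P := (formGraph J (√h)).starProjection F with hPdef
  have hPmem : (P.snd : Space N × Space N → ℝ) =ᵐ[jumpMeasure J] fun z => √h * diff P.fst z :=
    (formGraph J (√h)).starProjection_apply_mem F
  have hPform : InForm J P.fst := by
    refine ⟨Lp.memLp _, ?_⟩
    have h1 : MemLp (fun z => √h * diff P.fst z) 2 (jumpMeasure J) :=
      (memLp_congr_ae hPmem).1 (Lp.memLp _)
    have h2 := h1.const_mul (√h)⁻¹
    refine (memLp_congr_ae (ae_of_all _ fun z => ?_)).1 h2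
    field_simp
  refine ⟨P.fst, hPform, fun g hg => ?_⟩
  have hgd : MemLp (fun z => √h * diff g z) 2 (jumpMeasure J) := hg.2.const_mul _
  set G : WithLp 2 (Lp ℝ 2 (volume : Measure (Space N)) × Lp ℝ 2 (jumpMeasure J)) :=
    WithLp.toLp 2 (hg.1.toLp g, hgd.toLp _) with hG
  have hGmem : G ∈ formGraph J (√h) := by
    change ((hgd.toLp _ : Lp ℝ 2 (jumpMeasure J)) : Space N × Space N → ℝ)
      =ᵐ[jumpMeasure J] fun z => √h * diff (hg.1.toLp g) z
    filter_upwards [hgd.coeFn_toLp, diff_congr_jump (J := J) hg.1.coeFn_toLp] with z h1 h2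
    rw [h1, h2]
  have hort := Submodule.starProjection_inner_eq_zero (K := formGraph J (√h)) F G hGmem
  rw [WithLp.prod_inner_apply, L2.inner_def, L2.inner_def] at hort
  have e1 : ∫ x, inner ℝ ((F - P).ofLp.1 x) (G.ofLp.1 x) = - ∫ x, (P.fst x - f x) * g x := by
    rw [← integral_neg]
    refine integral_congr_ae ?_
    filter_upwards [hf.coeFn_toLp, hg.1.coeFn_toLp, Lp.coeFn_sub (hf.toLp f) P.fst] with x h1 h2 h3
    have h4 : (F - P).ofLp.1 x = f x - P.fst x := by
      rw [← h1]; exact h3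
    have h5 : G.ofLp.1 x = g x := h2
    rw [h4, h5]
    simp only [RCLike.inner_apply, conj_trivial]; ring
  have e2 : ∫ z, inner ℝ ((F - P).ofLp.2 z) (G.ofLp.2 z) ∂jumpMeasure J
      = - (h * energy J P.fst g) := by
    rw [energy, ← integral_const_mul, ← integral_neg]
    refine integral_congr_ae ?_
    filter_upwards [hgd.coeFn_toLp, hPmem, Lp.coeFn_sub (0 : Lp ℝ 2 (jumpMeasure J)) P.snd,
      Lp.coeFn_zero ℝ 2 (jumpMeasure J)] with z h1 h2 h3 h6
    have h4 : (F - P).ofLp.2 z = - (√h * diff P.fst z) := by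
      refine Eq.trans h3 ?_
      rw [Pi.sub_apply, h6, h2]; simp
    have h5 : G.ofLp.2 z = √h * diff g z := h1
    rw [h4, h5]
    simp only [RCLike.inner_apply, conj_trivial]
    nth_rewrite 3 [← Real.mul_self_sqrt hh]
    ring
  rw [← hPdef, e1, e2] at hort
  linarith

lemma IsResolvent.congr_right {h : ℝ} {f w w' : Space N → ℝ} (hw : IsResolvent J h f w)
    (hww : w =ᵐ[volume] w') : IsResolvent J h f w' := by
  refine ⟨hw.1.congr hww, fun g hg => ?_⟩
  rw [← energy_congr hww (ae_eq_refl g), ← hw.2 g hg]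
  congr 1
  refine integral_congr_ae ?_
  filter_upwards [hww] with x hx
  rw [hx]

/-- Truncation of a real number to `[-M, M]`. -/
def clamp (M s : ℝ) : ℝ := max (-M) (min s M)

lemma measurable_clamp (M : ℝ) : Measurable (clamp M) :=
  measurable_const.max (measurable_id.min measurable_const)

lemma abs_clamp_le {M : ℝ} (hM : 0 ≤ M) (s : ℝ) : |clamp M s| ≤ M := by
  rw [abs_le, clamp]
  exact ⟨le_max_left _ _, max_le (by linarith) (min_le_right _ _)⟩

lemma clamp_of_abs_le {M s : ℝ} (h : |s| ≤ M) : clamp M s = s := by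
  rw [abs_le] at h
  rw [clamp, min_eq_left h.2, max_eq_right h.1]

lemma abs_clamp_sub_le (M a b : ℝ) : |clamp M a - clamp M b| ≤ |a - b| := by
  refine (abs_max_sub_max_le_max _ _ _ _).trans (max_le (by simp) ?_)
  exact (abs_min_sub_min_le_max _ _ _ _).trans (max_le le_rfl (by simp))

lemma clamp_zero {M : ℝ} (hM : 0 ≤ M) : clamp M 0 = 0 := clamp_of_abs_le (by simpa using hM)

lemma abs_clamp_le_abs {M : ℝ} (hM : 0 ≤ M) (s : ℝ) : |clamp M s| ≤ |s| := by
  simpa [clamp_zero hM] using abs_clamp_sub_le M s 0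

lemma clamp_mono (M : ℝ) : Monotone (clamp M) := fun _ _ h =>
  max_le_max le_rfl (min_le_min h le_rfl)

lemma InForm.clamp {f : Space N → ℝ} (hf : InForm J f) {M : ℝ} (hM : 0 ≤ M) :
    InForm J (fun x => clamp M (f x)) :=
  hf.comp_of_abs_sub_le (measurable_clamp M) (clamp_zero hM) (K := 1) (S := univ)
    (fun _ => mem_univ _) (mem_univ _) (fun a _ b _ => by simpa using abs_clamp_sub_le M a b)

/-- The resolvent is Markovian. -/
lemma IsResolvent.ae_abs_le {h : ℝ} (hh : 0 ≤ h) {f w : Space N → ℝ} (hw : IsResolvent J h f w)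
    (hf : MemLp f 2 volume) {M : ℝ} (hM : ∀ x, |f x| ≤ M) :
    (fun x => clamp M (w x)) =ᵐ[volume] w := by
  have hM0 : 0 ≤ M := (abs_nonneg _).trans (hM 0)
  -- The excess over the truncation is the test function. Both s ↦ s and s ↦ s - clamp s are
  -- nondecreasing, so its energy against w is nonnegative. Since |f| ≤ M, the other term dominates
  -- the square of the excess.
  have hg : InForm J (fun x => w x - LevyHyper.clamp M (w x)) := hw.1.sub (hw.1.clamp hM0)
  have heq := hw.2 _ hg
  have hpos : 0 ≤ energy J w (fun x => w x - LevyHyper.clamp M (w x)) := by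
    refine integral_nonneg fun z => ?_
    simp only [diff, Pi.zero_apply]
    have h1 := abs_clamp_sub_le M (w z.1) (w z.2)
    rcases le_total (w z.2) (w z.1) with hle | hle
    · have := clamp_mono M hle
      rw [abs_of_nonneg (by linarith), abs_of_nonneg (by linarith)] at h1
      exact mul_nonneg (by linarith) (by linarith)
    · have := clamp_mono M hle
      rw [abs_of_nonpos (by linarith), abs_of_nonpos (by linarith)] at h1
      exact mul_nonneg_of_nonpos_of_nonpos (by linarith) (by linarith)
  have hint1 : Integrable (fun x => (w x - f x) * (w x - LevyHyper.clamp M (w x))) :=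
    (hw.1.1.sub hf).integrable_mul hg.1
  have hint2 : Integrable (fun x => (w x - LevyHyper.clamp M (w x)) ^ 2) := hg.1.integrable_sq
  have hle : ∫ x, (w x - LevyHyper.clamp M (w x)) ^ 2
      ≤ ∫ x, (w x - f x) * (w x - LevyHyper.clamp M (w x)) := by
    refine integral_mono hint2 hint1 fun x => ?_
    simp only
    have hfx := abs_le.1 (hM x)
    rcases le_total (w x) M with h1 | h1
    · rcases le_total (-M) (w x) with h2 | h2
      · rw [clamp_of_abs_le (abs_le.2 ⟨h2, h1⟩)]; simp
      · have : LevyHyper.clamp M (w x) = -M := by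
          rw [LevyHyper.clamp, min_eq_left h1, max_eq_left h2]
        rw [this]; nlinarith
    · have : LevyHyper.clamp M (w x) = M := by
        rw [LevyHyper.clamp, min_eq_right h1, max_eq_right (by linarith)]
      rw [this]; nlinarith
  have hzero : ∫ x, (w x - LevyHyper.clamp M (w x)) ^ 2 = 0 := by
    refine le_antisymm ?_ (integral_nonneg fun x => sq_nonneg _)
    have := mul_nonneg hh hpos
    linarith
  rw [integral_eq_zero_iff_of_nonneg (fun x => sq_nonneg _) hint2] at hzero
  filter_upwards [hzero] with x hx
  have : (w x - LevyHyper.clamp M (w x)) ^ 2 = 0 := hx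
  have := pow_eq_zero_iff (two_ne_zero) |>.1 this
  linarith

/-- Bounded data have a bounded measurable resolvent. -/
lemma exists_isResolvent_bounded {h : ℝ} (hh : 0 < h) {f : Space N → ℝ} (hf : MemLp f 2 volume)
    {M : ℝ} (hM : ∀ x, |f x| ≤ M) :
    ∃ w, Measurable w ∧ (∀ x, |w x| ≤ M) ∧ IsResolvent J h f w := by
  have hM0 : 0 ≤ M := (abs_nonneg _).trans (hM 0)
  obtain ⟨w, hw⟩ := exists_isResolvent (J := J) hh.le hf hh.ne'
  have h1 := hw.1.1.1.aemeasurable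
  have h2 : h1.mk w =ᵐ[volume] w := h1.ae_eq_mk.symm
  refine ⟨fun x => clamp M (h1.mk w x), (measurable_clamp M).comp h1.measurable_mk,
    fun x => abs_clamp_le hM0 _, hw.congr_right ?_⟩
  filter_upwards [h2, hw.ae_abs_le hh.le hf hM] with x hx1 hx2
  rw [hx1, hx2]

lemma IsResolvent.sub {h : ℝ} {f f' w w' : Space N → ℝ} (hw : IsResolvent J h f w)
    (hw' : IsResolvent J h f' w') (hf : MemLp f 2 volume) (hf' : MemLp f' 2 volume) :
    IsResolvent J h (fun x => f x - f' x) (fun x => w x - w' x) := by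
  refine ⟨hw.1.sub hw'.1, fun g hg => ?_⟩
  rw [energy_sub_left hw.1 hw'.1 hg]
  have h1 : Integrable (fun x => (w x - f x) * g x) := (hw.1.1.sub hf).integrable_mul hg.1
  have h2 : Integrable (fun x => (w' x - f' x) * g x) := (hw'.1.1.sub hf').integrable_mul hg.1
  have h3 : ∫ x, (w x - w' x - (f x - f' x)) * g x
      = (∫ x, (w x - f x) * g x) - ∫ x, (w' x - f' x) * g x := by
    rw [← integral_sub h1 h2]
    congr 1; funext x; ring
  simp only [h3]
  have := hw.2 g hg
  have := hw'.2 g hg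
  linarith

lemma eLpNorm_two_eq {α : Type*} [MeasurableSpace α] {μ : Measure α} {f : α → ℝ}
    (hf : MemLp f 2 μ) : eLpNorm f 2 μ = ENNReal.ofReal (√(∫ x, f x ^ 2 ∂μ)) := by
  rw [hf.eLpNorm_eq_integral_rpow_norm two_ne_zero ENNReal.ofNat_ne_top, Real.sqrt_eq_rpow]
  simp

/-- Test the equation with w itself and use (w - f)w ≥ (w² - f²)/2. -/
lemma IsResolvent.integral_sq_le {h : ℝ} (hh : 0 ≤ h) {f w : Space N → ℝ}
    (hw : IsResolvent J h f w) (hf : MemLp f 2 volume) : ∫ x, w x ^ 2 ≤ ∫ x, f x ^ 2 := by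
  have h1 := hw.2 w hw.1
  have h2 := mul_nonneg hh (energy_self_nonneg (J := J) w)
  have h3 : Integrable (fun x => (w x - f x) * w x) := (hw.1.1.sub hf).integrable_mul hw.1.1
  have h4 : ∫ x, (1 / 2 * w x ^ 2 - 1 / 2 * f x ^ 2) ≤ ∫ x, (w x - f x) * w x := by
    refine integral_mono ((hw.1.1.integrable_sq.const_mul _).sub (hf.integrable_sq.const_mul _))
      h3 fun x => ?_
    simp only
    nlinarith [sq_nonneg (w x - f x)]
  rw [integral_sub (hw.1.1.integrable_sq.const_mul _) (hf.integrable_sq.const_mul _),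
    integral_const_mul, integral_const_mul] at h4
  linarith

lemma IsResolvent.eLpNorm_le {h : ℝ} (hh : 0 ≤ h) {f w : Space N → ℝ}
    (hw : IsResolvent J h f w) (hf : MemLp f 2 volume) : eLpNorm w 2 volume ≤ eLpNorm f 2 volume := by
  rw [eLpNorm_two_eq hf, eLpNorm_two_eq hw.1.1]
  exact ENNReal.ofReal_le_ofReal (Real.sqrt_le_sqrt (hw.integral_sq_le hh hf))

/-- The resolvent of a function in the form domain is close to it. -/
lemma IsResolvent.integral_sub_sq_le {h : ℝ} (hh : 0 ≤ h) {f w : Space N → ℝ}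
    (hw : IsResolvent J h f w) (hf : InForm J f) :
    ∫ x, (w x - f x) ^ 2 ≤ h * energy J f f := by
  -- Testing with w - f gives ‖w - f‖² = h(E(f,w) - E(w,w)), and positivity of E(w - f, w - f)
  -- bounds the mixed term by the mean of E(f,f) and E(w,w).
  have h1 := hw.2 _ (hw.1.sub hf)
  have h2 := energy_self_nonneg (J := J) (fun x => w x - f x)
  have h4 := energy_self_nonneg (J := J) w
  have h5 : energy J w f = energy J f w := by
    rw [energy, energy]; congr 1; funext z; ring
  rw [energy_sub_left hw.1 hf (hw.1.sub hf), energy_sub_right hw.1 hw.1 hf,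
    energy_sub_right hf hw.1 hf] at h2
  rw [energy_sub_right hw.1 hw.1 hf] at h1
  have h6 : ∫ x, (w x - f x) ^ 2 = ∫ x, (w x - f x) * (w x - f x) := by
    congr 1; funext x; ring
  rw [h6]
  rw [h5] at h1 h2
  nlinarith [mul_nonneg hh h2, mul_nonneg hh h4, mul_nonneg hh (energy_self_nonneg (J := J) f)]

/-! ### Implicit Euler chains -/

/-- A chain of bounded implicit Euler steps of size `h`. -/
structure IsEulerChain (J : Space N → Space N → ℝ≥0) (h M : ℝ) (W : ℕ → Space N → ℝ) : Prop where
  measurable : ∀ k, Measurable (W k)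
  bounded : ∀ k x, |W k x| ≤ M
  memLp : ∀ k, MemLp (W k) 2 volume
  step : ∀ k, IsResolvent J h (W k) (W (k + 1))

lemma exists_isEulerChain {h : ℝ} (hh : 0 < h) {M : ℝ} {w : Space N → ℝ} (hw : Measurable w)
    (hM : ∀ x, |w x| ≤ M) (hL : MemLp w 2 volume) :
    ∃ W, W 0 = w ∧ IsEulerChain J h M W := by
  let S := {u : Space N → ℝ // Measurable u ∧ (∀ x, |u x| ≤ M) ∧ MemLp u 2 volume}
  have hex : ∀ u : S, ∃ u' : S, IsResolvent J h u.1 u'.1 := fun u => by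
    obtain ⟨u', h1, h2, h3⟩ := exists_isResolvent_bounded (J := J) hh u.2.2.2 u.2.2.1
    exact ⟨⟨u', h1, h2, h3.1.1⟩, h3⟩
  choose F hF using hex
  let W : ℕ → S := fun k => F^[k] ⟨w, hw, hM, hL⟩
  refine ⟨fun k => (W k).1, rfl, fun k => (W k).2.1, fun k => (W k).2.2.1,
    fun k => (W k).2.2.2, fun k => ?_⟩
  have : W (k + 1) = F (W k) := Function.iterate_succ_apply' F k _
  simp only [this]
  exact hF _

lemma IsEulerChain.integral_sq_le {h M : ℝ} (hh : 0 ≤ h) {W : ℕ → Space N → ℝ}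
    (hW : IsEulerChain J h M W) (k : ℕ) : ∫ x, W k x ^ 2 ≤ ∫ x, W 0 x ^ 2 := by
  induction k with
  | zero => exact le_rfl
  | succ k ih => exact ((hW.step k).integral_sq_le hh (hW.memLp k)).trans ih

/-- By linearity each increment is the resolvent of the preceding one, so L² contraction makes the
first increment the largest. -/
lemma IsEulerChain.integral_sub_sq_le {h M : ℝ} (hh : 0 ≤ h) {W : ℕ → Space N → ℝ}
    (hW : IsEulerChain J h M W) (k : ℕ) :
    ∫ x, (W (k + 1) x - W k x) ^ 2 ≤ ∫ x, (W 1 x - W 0 x) ^ 2 := by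
  induction k with
  | zero => exact le_rfl
  | succ k ih =>
    exact (((hW.step (k + 1)).sub (hW.step k) (hW.memLp _) (hW.memLp _)).integral_sq_le hh
      ((hW.memLp _).sub (hW.memLp _))).trans ih

/-- If the initial value is itself a resolvent, the first increment is of order `h`. -/
lemma IsEulerChain.integral_first_sub_sq_le {h M ε : ℝ} (hh : 0 ≤ h) (hε : 0 < ε)
    {W : ℕ → Space N → ℝ} (hW : IsEulerChain J h M W) {f : Space N → ℝ} (hf : MemLp f 2 volume)
    (hfW : IsResolvent J ε f (W 0)) :
    ∫ x, (W 1 x - W 0 x) ^ 2 ≤ (h / ε) ^ 2 * ∫ x, (W 0 x - f x) ^ 2 := by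
  have hr : MemLp (fun x => h / ε * (W 0 x - f x)) 2 volume :=
    (hfW.1.1.sub hf).const_mul _
  -- The equation for `W 0` reads L W₀ = (f - W₀)/ε. Hence the increment d satisfies d + hLd = -hLW₀
  -- = (h/ε)(W₀ - f).
  have hd : IsResolvent J h (fun x => h / ε * (W 0 x - f x)) (fun x => W 1 x - W 0 x) := by
    refine ⟨(hW.step 0).1.sub hfW.1, fun g hg => ?_⟩
    have h1 := (hW.step 0).2 g hg
    have h2 := hfW.2 g hg
    simp only [zero_add] at h1
    rw [energy_sub_left (hW.step 0).1 hfW.1 hg]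
    have i1 : Integrable (fun x => (W 1 x - W 0 x) * g x) :=
      ((hW.memLp 1).sub (hW.memLp 0)).integrable_mul hg.1
    have i2 : Integrable (fun x => (W 0 x - f x) * g x) := (hfW.1.1.sub hf).integrable_mul hg.1
    have h3 : ∫ x, (W 1 x - W 0 x - h / ε * (W 0 x - f x)) * g x
        = (∫ x, (W 1 x - W 0 x) * g x) - h / ε * ∫ x, (W 0 x - f x) * g x := by
      rw [← integral_const_mul, ← integral_sub i1 (i2.const_mul _)]
      congr 1; funext x; ring
    simp only [h3, zero_add]
    have h4 : ∫ x, (W 0 x - f x) * g x = - (ε * energy J (W 0) g) := by linarith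
    rw [h4]
    field_simp
    linarith
  have := hd.integral_sq_le hh hr
  refine this.trans_eq ?_
  rw [← integral_const_mul]
  congr 1; funext x; ring

/-! ### Convergence of the scheme and regular initial data -/

lemma IsMildSolution.inForm (hJ : IsLevyKernel J) {v : ℝ → Lp ℝ 2 (volume : Measure (Space N))}
    (hv : IsMildSolution J v) {t : ℝ} (ht : 0 < t) : InForm J (v t) :=
  (memEnergySpace_iff hJ).1 (hv.memEnergySpace t ht)

/-- Because Lv = -v', the value v(t) is an exact Euler step from v(t) - h v'(t). Its distance from
v(t - h) is therefore the consistency error of the scheme. -/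
lemma IsMildSolution.isResolvent (hJ : IsLevyKernel J)
    {v : ℝ → Lp ℝ 2 (volume : Measure (Space N))}
    (hv : IsMildSolution J v) {t : ℝ} (ht : 0 < t) (h : ℝ) :
    IsResolvent J h (v t - h • deriv v t : Lp ℝ 2 (volume : Measure (Space N))) (v t) := by
  refine ⟨hv.inForm hJ ht, fun g hg => ?_⟩
  have hg' : InForm J (hg.1.toLp g) := hg.congr hg.1.coeFn_toLp.symm
  have h1 := hv.equation t ht (hg.1.toLp g) ((memEnergySpace_iff hJ).2 hg')
  rw [dirichletForm_eq hJ (hv.inForm hJ ht) hg', energy_congr (ae_eq_refl _) hg.1.coeFn_toLp,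
    L2.inner_def, ← EReal.coe_add, ← EReal.coe_zero, EReal.coe_eq_coe_iff] at h1
  have h2 : ∫ x, (v t x - (v t - h • deriv v t : Lp ℝ 2 (volume : Measure (Space N))) x) * g x
      = h * ∫ x, inner ℝ (deriv v t x) (hg.1.toLp g x) := by
    rw [← integral_const_mul]
    refine integral_congr_ae ?_
    filter_upwards [Lp.coeFn_sub (v t) (h • deriv v t), Lp.coeFn_smul h (deriv v t),
      hg.1.coeFn_toLp] with x e1 e2 e3
    rw [e1, e3, Pi.sub_apply, e2]
    simp only [Pi.smul_apply, smul_eq_mul, RCLike.inner_apply, conj_trivial]; ring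
  rw [h2, ← mul_add, h1, mul_zero]

lemma eLpNorm_Lp_sub_eq (u w : Lp ℝ 2 (volume : Measure (Space N))) :
    eLpNorm (fun x => u x - w x) 2 volume = ENNReal.ofReal ‖u - w‖ := by
  rw [Lp.norm_def, ENNReal.ofReal_toReal (Lp.eLpNorm_ne_top _)]
  refine eLpNorm_congr_ae ?_
  filter_upwards [Lp.coeFn_sub u w] with x hx
  rw [hx]; rfl

lemma eLpNorm_sub_le_add {f g k : Space N → ℝ} (hf : MemLp f 2 volume) (hg : MemLp g 2 volume)
    (hk : MemLp k 2 volume) :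
    eLpNorm (fun x => f x - k x) 2 volume ≤
      eLpNorm (fun x => f x - g x) 2 volume + eLpNorm (fun x => g x - k x) 2 volume := by
  have := eLpNorm_add_le (hf.1.sub hg.1) (hg.1.sub hk.1) (p := 2) one_le_two
  refine le_trans (le_of_eq ?_) this
  congr 1; funext x; simp

/-- Consistency of the implicit Euler scheme. -/
lemma IsMildSolution.exists_step_error {v : ℝ → Lp ℝ 2 (volume : Measure (Space N))}
    (hv : IsMildSolution J v) {a b : ℝ} (ha : 0 < a) {ε : ℝ} (hε : 0 < ε) :
    ∃ δ > 0, ∀ s t, a ≤ s → s ≤ t → t ≤ b → t - s ≤ δ →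
      ‖v s - (v t - (t - s) • deriv v t)‖ ≤ ε * (t - s) := by
  have hc : ContinuousOn (deriv v) (Icc a b) :=
    (hv.contDiffOn.continuousOn_deriv_of_isOpen isOpen_Ioi le_rfl).mono
      fun x hx => ha.trans_le hx.1
  have huc := isCompact_Icc.uniformContinuousOn_of_continuous hc
  rw [Metric.uniformContinuousOn_iff_le] at huc
  obtain ⟨δ, hδ, H⟩ := huc ε hε
  refine ⟨δ, hδ, fun s t has hst htb hts => ?_⟩
  -- The mean value inequality is applied to v(r) - r v'(t), whose derivative is small by uniform
  -- continuity of v' on [a,b].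
  have hd : ∀ r ∈ Icc s t, HasDerivWithinAt (fun r => v r - r • deriv v t)
      (deriv v r - (1 : ℝ) • deriv v t) (Icc s t) r := fun r hr => by
    have h0 : 0 < r := ha.trans_le (has.trans hr.1)
    have h1 : DifferentiableAt ℝ v r :=
      (hv.contDiffOn.differentiableOn one_ne_zero).differentiableAt (Ioi_mem_nhds h0)
    exact (h1.hasDerivAt.sub ((hasDerivAt_id r).smul_const (deriv v t))).hasDerivWithinAt
  have hb : ∀ r ∈ Icc s t, ‖deriv v r - (1 : ℝ) • deriv v t‖ ≤ ε := fun r hr => by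
    rw [one_smul, ← dist_eq_norm]
    refine H r ⟨has.trans hr.1, hr.2.trans htb⟩ t ⟨has.trans hst, htb⟩ ?_
    rw [Real.dist_eq, abs_of_nonpos (by linarith [hr.2])]
    linarith [hr.1]
  have := (convex_Icc s t).norm_image_sub_le_of_norm_hasDerivWithin_le hd hb
    (right_mem_Icc.2 hst) (left_mem_Icc.2 hst)
  rw [Real.norm_eq_abs, abs_of_nonpos (by linarith)] at this
  have e : v s - (v t - (t - s) • deriv v t)
      = v s - s • deriv v t - (v t - t • deriv v t) := by
    rw [sub_smul]; abel
  rw [e]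
  linarith

/-- Convergence of the implicit Euler scheme towards a mild solution. -/
lemma IsMildSolution.euler_converges (hJ : IsLevyKernel J)
    {v : ℝ → Lp ℝ 2 (volume : Measure (Space N))}
    (hv : IsMildSolution J v) {a b : ℝ} (ha : 0 < a) (hab : a < b) {ε : ℝ} (hε : 0 < ε) :
    ∃ n₀ : ℕ, ∀ n : ℕ, n₀ ≤ n → 0 < n → ∀ (M : ℝ) (W : ℕ → Space N → ℝ),
      IsEulerChain J ((b - a) / n) M W →
      eLpNorm (fun x => W n x - v b x) 2 volume
        ≤ eLpNorm (fun x => W 0 x - v a x) 2 volume + ENNReal.ofReal ε := by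
  have hba : 0 < b - a := sub_pos.2 hab
  obtain ⟨δ, hδ, H⟩ := hv.exists_step_error (b := b) ha (div_pos hε hba)
  obtain ⟨n₀, hn₀⟩ := exists_nat_gt ((b - a) / δ)
  refine ⟨n₀, fun n hn hn0 M W hW => ?_⟩
  have hnpos : (0 : ℝ) < n := Nat.cast_pos.2 hn0
  set h := (b - a) / n with hh
  have hhpos : 0 < h := div_pos hba hnpos
  have hhδ : h ≤ δ := by
    rw [hh, div_le_iff₀ hnpos]
    rw [div_lt_iff₀ hδ] at hn₀
    have : (n₀ : ℝ) ≤ n := Nat.cast_le.2 hn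
    nlinarith
  have hnh : n * h = b - a := by rw [hh]; field_simp
  -- The resolvent contracts the error already present, and each step adds at most ε h/(b - a), so
  -- after n steps the total added is ε.
  have key : ∀ k : ℕ, k ≤ n → eLpNorm (fun x => W k x - v (a + k * h) x) 2 volume
      ≤ eLpNorm (fun x => W 0 x - v a x) 2 volume
        + ENNReal.ofReal (ε / (b - a) * (k * h)) := by
    intro k
    induction k with
    | zero => intro _; simp
    | succ k ih =>
      intro hk
      have ih' := ih (Nat.le_of_succ_le hk)
      set s := a + k * h with hs
      set t := a + (k + 1 : ℕ) * h with ht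
      have hts : t - s = h := by rw [ht, hs]; push_cast; ring
      have has : a ≤ s := by rw [hs]; have := mul_nonneg (Nat.cast_nonneg (α := ℝ) k) hhpos.le; linarith
      have hst : s ≤ t := by linarith
      have htb : t ≤ b := by
        have : ((k + 1 : ℕ) : ℝ) ≤ n := Nat.cast_le.2 hk
        have := mul_le_mul_of_nonneg_right this hhpos.le
        linarith
      have h1 := H s t has hst htb (hts.le.trans hhδ)
      rw [hts] at h1
      have hr := hv.isResolvent hJ (ha.trans_le (has.trans hst)) h
      have h2 := ((hW.step k).sub hr (hW.memLp k) (Lp.memLp _)).eLpNorm_le hhpos.le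
        ((hW.memLp k).sub (Lp.memLp _))
      refine h2.trans ?_
      refine (eLpNorm_sub_le_add (hW.memLp k) (Lp.memLp (v s)) (Lp.memLp _)).trans ?_
      rw [eLpNorm_Lp_sub_eq]
      have h3 : ENNReal.ofReal (ε / (b - a) * ((k + 1 : ℕ) * h))
          = ENNReal.ofReal (ε / (b - a) * (k * h)) + ENNReal.ofReal (ε / (b - a) * h) := by
        rw [← ENNReal.ofReal_add (by positivity) (by positivity)]
        congr 1; push_cast; ring
      rw [h3, ← add_assoc]
      exact add_le_add ih' (ENNReal.ofReal_le_ofReal h1)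
  have := key n le_rfl
  rw [hnh, add_sub_cancel, div_mul_cancel₀ _ hba.ne'] at this
  exact this

lemma tendsto_eLpNorm_clamp {f : Space N → ℝ} (hf : MemLp f 2 volume) :
    Tendsto (fun n : ℕ => eLpNorm (fun x => clamp n (f x) - f x) 2 volume) atTop (𝓝 0) := by
  have hm : ∀ n : ℕ, AEStronglyMeasurable (fun x => clamp n (f x)) volume := fun n =>
    ((measurable_clamp n).comp_aemeasurable hf.1.aemeasurable).aestronglyMeasurable
  have hL : ∀ n : ℕ, MemLp (fun x => clamp n (f x)) 2 volume := fun n =>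
    hf.of_le (hm n) (ae_of_all _ fun x => abs_clamp_le_abs (Nat.cast_nonneg n) _)
  have h1 : ∀ n : ℕ, eLpNorm (fun x => clamp n (f x) - f x) 2 volume
      = ENNReal.ofReal (√(∫ x, (clamp n (f x) - f x) ^ 2)) := fun n =>
    eLpNorm_two_eq ((hL n).sub hf)
  simp_rw [h1]
  have h2 : Tendsto (fun n : ℕ => ∫ x, (clamp n (f x) - f x) ^ 2) atTop (𝓝 (∫ _ : Space N, (0 : ℝ))) := by
    refine tendsto_integral_of_dominated_convergence (fun x => 4 * f x ^ 2)
      (fun n => ((hm n).sub hf.1).pow 2) (hf.integrable_sq.const_mul 4)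
      (fun n => ae_of_all _ fun x => ?_) (ae_of_all _ fun x => ?_)
    · have := abs_clamp_le_abs (Nat.cast_nonneg n) (f x)
      rw [Real.norm_eq_abs, abs_of_nonneg (sq_nonneg _)]
      have h3 := sq_le_sq' (by linarith [abs_nonneg (f x), abs_nonneg (clamp n (f x))]) this
      rw [sq_abs, sq_abs] at h3
      nlinarith [sq_nonneg (clamp n (f x) + f x)]
    · refine tendsto_const_nhds.congr' ?_
      obtain ⟨n, hn⟩ := exists_nat_ge |f x|
      filter_upwards [eventually_ge_atTop n] with m hm
      rw [clamp_of_abs_le (hn.trans (Nat.cast_le.2 hm))]; simp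
  rw [integral_zero] at h2
  have h3 := (ENNReal.continuous_ofReal.tendsto _).comp ((Real.continuous_sqrt.tendsto _).comp h2)
  simpa using! h3

/-- Approximation of the initial datum by bounded resolvents. -/
lemma IsMildSolution.exists_regular_datum (hJ : IsLevyKernel J)
    {v : ℝ → Lp ℝ 2 (volume : Measure (Space N))} (hv : IsMildSolution J v) {η : ℝ} (hη : 0 < η) :
    ∃ (M ε : ℝ) (w : Space N → ℝ), 0 < ε ∧ 0 ≤ M ∧ Measurable w ∧ (∀ x, |w x| ≤ M) ∧
      IsResolvent J ε (fun x => clamp M (v 0 x)) w ∧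
      eLpNorm (fun x => w x - v 0 x) 2 volume ≤ ENNReal.ofReal η := by
  have hη4 : 0 < η / 4 := by positivity
  have hη' : 0 < ENNReal.ofReal (η / 4) := ENNReal.ofReal_pos.2 hη4
  obtain ⟨n, hn⟩ := ((tendsto_eLpNorm_clamp (Lp.memLp (v 0))).eventually_le_const hη').exists
  set M : ℝ := (n : ℝ)
  have hM : 0 ≤ M := Nat.cast_nonneg n
  -- The truncated datum may have infinite energy, so closeness to its resolvent is obtained through
  -- the truncation of v(a) with a > 0, which lies in the form domain.
  obtain ⟨a, ha, hav⟩ : ∃ a > 0, ‖v a - v 0‖ ≤ η / 4 := by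
    have h1 : Tendsto v (𝓝[>] 0) (𝓝 (v 0)) :=
      (hv.continuousOn 0 self_mem_Ici).mono_left (nhdsWithin_mono _ Ioi_subset_Ici_self)
    have h2 : ∀ᶠ a in 𝓝[>] (0 : ℝ), ‖v a - v 0‖ < η / 4 := by
      have := h1.eventually (Metric.ball_mem_nhds _ hη4)
      filter_upwards [this] with a ha
      rwa [← dist_eq_norm]
    obtain ⟨a, h3, h4⟩ := (h2.and self_mem_nhdsWithin).exists
    exact ⟨a, h4, h3.le⟩
  have hclm : ∀ t, MemLp (fun x => clamp M (v t x)) 2 volume := fun t =>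
    (Lp.memLp (v t)).of_le (((measurable_clamp M).comp_aemeasurable
      (Lp.memLp (v t)).1.aemeasurable).aestronglyMeasurable)
      (ae_of_all _ fun x => abs_clamp_le_abs hM _)
  have hfa : InForm J (fun x => clamp M (v a x)) := (hv.inForm hJ ha).clamp hM
  set E := energy J (fun x => clamp M (v a x)) (fun x => clamp M (v a x)) with hE
  have hE0 : 0 ≤ E := energy_self_nonneg _
  -- This choice gives √(εE) ≤ η/4, and the 1 guards against E = 0.
  set ε := (η / 4) ^ 2 / (E + 1) with hεdef
  have hε : 0 < ε := by positivity
  obtain ⟨w, hwm, hwb, hw⟩ := exists_isResolvent_bounded (J := J) hε (hclm 0)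
    (fun x => abs_clamp_le hM (v 0 x))
  obtain ⟨u, hu⟩ := exists_isResolvent (J := J) hε.le (hclm a) hε.ne'
  refine ⟨M, ε, w, hε, hM, hwm, hwb, hw, ?_⟩
  have e1 : eLpNorm (fun x => clamp M (v a x) - clamp M (v 0 x)) 2 volume
      ≤ ENNReal.ofReal (η / 4) := by
    refine le_trans (eLpNorm_mono fun x => ?_) ((eLpNorm_Lp_sub_eq (v a) (v 0)).le.trans
      (ENNReal.ofReal_le_ofReal hav))
    exact abs_clamp_sub_le M _ _
  have e1' : eLpNorm (fun x => clamp M (v 0 x) - clamp M (v a x)) 2 volume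
      ≤ ENNReal.ofReal (η / 4) := by
    refine le_trans (eLpNorm_mono fun x => ?_) e1
    rw [norm_sub_rev]
  have e2 : eLpNorm (fun x => w x - u x) 2 volume ≤ ENNReal.ofReal (η / 4) :=
    ((hw.sub hu (hclm 0) (hclm a)).eLpNorm_le hε.le ((hclm 0).sub (hclm a))).trans e1'
  have e3 : eLpNorm (fun x => u x - clamp M (v a x)) 2 volume ≤ ENNReal.ofReal (η / 4) := by
    have h1 := hu.integral_sub_sq_le hε.le hfa
    have h2 : eLpNorm (fun x => u x - clamp M (v a x)) 2 volume
      = ENNReal.ofReal (√(∫ x, (u x - clamp M (v a x)) ^ 2)) := eLpNorm_two_eq (hu.1.1.sub (hclm a))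
    rw [h2]
    refine ENNReal.ofReal_le_ofReal (Real.sqrt_le_iff.2 ⟨hη4.le, h1.trans ?_⟩)
    rw [← hE, hεdef, div_mul_eq_mul_div, div_le_iff₀ (by positivity)]
    nlinarith [sq_nonneg (η / 4)]
  calc eLpNorm (fun x => w x - v 0 x) 2 volume
      ≤ eLpNorm (fun x => w x - u x) 2 volume + (eLpNorm (fun x => u x - clamp M (v a x)) 2 volume
        + (eLpNorm (fun x => clamp M (v a x) - clamp M (v 0 x)) 2 volume
        + eLpNorm (fun x => clamp M (v 0 x) - v 0 x) 2 volume)) := by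
        refine (eLpNorm_sub_le_add hw.1.1 hu.1.1 (Lp.memLp _)).trans (add_le_add le_rfl ?_)
        refine (eLpNorm_sub_le_add hu.1.1 (hclm a) (Lp.memLp _)).trans (add_le_add le_rfl ?_)
        exact eLpNorm_sub_le_add (hclm a) (hclm 0) (Lp.memLp _)
    _ ≤ ENNReal.ofReal (η / 4) + (ENNReal.ofReal (η / 4) + (ENNReal.ofReal (η / 4)
        + ENNReal.ofReal (η / 4))) :=
        add_le_add e2 (add_le_add e3 (add_le_add e1 hn))
    _ = ENNReal.ofReal η := by
        rw [← ENNReal.ofReal_add hη4.le hη4.le, ← ENNReal.ofReal_add hη4.le (by positivity),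
          ← ENNReal.ofReal_add hη4.le (by positivity)]
        congr 1; ring

/-! ### Estimates and derivatives for powers with exponent above 2 -/

/-- `r ↦ |s|^(r-2)` and its product with `|log s|` are bounded on bounded sets, uniformly for `r`
in a compact subset of `(2, ∞)`. -/
lemma exists_rpow_bounds {r₀ r₁ M : ℝ} (h0 : 2 < r₀) (hM : 1 ≤ M) :
    ∃ K, 1 ≤ K ∧ ∀ r, r₀ ≤ r → r ≤ r₁ → ∀ s : ℝ, |s| ≤ M →
      |s| ^ (r - 2) ≤ K ∧ |s| ^ (r - 2) * |Real.log s| ≤ K := by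
  have hM0 : 0 ≤ M := by linarith
  have hP : 0 ≤ M ^ (r₁ - 2) := Real.rpow_nonneg hM0 _
  -- The first two terms serve |s| ≤ 1, where |s|^a |log s| ≤ 1/a for a > 0. The last serves 1 ≤ |s|
  -- ≤ M, where log|s| ≤ M.
  refine ⟨1 + 1 / (r₀ - 2) + M ^ (r₁ - 2) * (1 + M), ?_, fun r hr0 hr1 s hs => ?_⟩
  · have : 0 < 1 / (r₀ - 2) := by apply one_div_pos.2; linarith
    have := mul_nonneg hP (by linarith : 0 ≤ 1 + M)
    linarith
  have h2 : 0 < 1 / (r₀ - 2) := by apply one_div_pos.2; linarith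
  have hr : 0 < r - 2 := by linarith
  have hprod := mul_nonneg hP hM0
  rcases le_total |s| 1 with h1 | h1
  · constructor
    · have := Real.rpow_le_one (abs_nonneg s) h1 hr.le
      nlinarith
    · rcases eq_or_ne s 0 with rfl | hs0
      · simp only [abs_zero, Real.log_zero, mul_zero]; nlinarith
      · have h3 := Real.abs_log_mul_self_rpow_lt |s| (r - 2) (abs_pos.2 hs0) h1 hr
        rw [Real.log_abs, abs_mul, abs_of_nonneg (Real.rpow_nonneg (abs_nonneg s) _),
          mul_comm] at h3
        have h4 : 1 / (r - 2) ≤ 1 / (r₀ - 2) := one_div_le_one_div_of_le (by linarith) (by linarith)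
        nlinarith
  · have h3 : |s| ^ (r - 2) ≤ M ^ (r₁ - 2) :=
      (Real.rpow_le_rpow (abs_nonneg s) hs hr.le).trans
        (Real.rpow_le_rpow_of_exponent_le hM (by linarith))
    have h4 : |Real.log s| ≤ M := by
      rw [← Real.log_abs, abs_of_nonneg (Real.log_nonneg h1)]
      have := Real.log_le_sub_one_of_pos (by linarith : 0 < |s|)
      linarith
    have h5 := mul_le_mul h3 h4 (abs_nonneg _) hP
    constructor <;> nlinarith

lemma abs_rpow_eq {r : ℝ} (hr : 2 < r) (s : ℝ) : |s| ^ r = |s| ^ (r - 2) * s ^ 2 := by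
  rcases eq_or_ne s 0 with rfl | hs
  · simp [Real.zero_rpow (by linarith : r ≠ 0)]
  · rw [← sq_abs s, ← Real.rpow_natCast |s| 2, ← Real.rpow_add (abs_pos.2 hs)]
    norm_num

lemma hasDerivAt_zero_of_abs_le_sq {f : ℝ → ℝ} {t K : ℝ} (h : ∀ᶠ x in 𝓝 t, |f x| ≤ K * (x - t) ^ 2) :
    HasDerivAt f 0 t := by
  have h0 : f t = 0 := by simpa using h.self_of_nhds
  rw [hasDerivAt_iff_isLittleO]
  have h1 : (fun x => f x - f t - (x - t) • (0 : ℝ)) =O[𝓝 t] fun x => (x - t) ^ 2 := by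
    refine Asymptotics.IsBigO.of_bound K ?_
    filter_upwards [h] with x hx
    simpa [h0] using hx
  refine h1.trans_isLittleO ?_
  refine Asymptotics.isLittleO_iff.2 fun c hc => ?_
  have h2 : ∀ᶠ x in 𝓝 t, |x - t| ≤ c := by
    filter_upwards [Metric.closedBall_mem_nhds t hc] with x hx
    simpa [Real.dist_eq] using hx
  filter_upwards [h2] with x hx
  rw [Real.norm_eq_abs, Real.norm_eq_abs, abs_pow, pow_two]
  exact mul_le_mul_of_nonneg_right hx (abs_nonneg _)

/-- The derivative of `|s|^r log s`. -/
lemma hasDerivAt_rpow_mul_log {r : ℝ} (hr : 2 < r) (s : ℝ) :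
    HasDerivAt (fun s : ℝ => |s| ^ r * Real.log s)
      (r * (|s| ^ (r - 2) * Real.log s) * s + |s| ^ (r - 2) * s) s := by
  rcases eq_or_ne s 0 with rfl | hs
  · simp only [mul_zero, add_zero]
    obtain ⟨K, hK1, hK⟩ := exists_rpow_bounds (r₁ := r) hr le_rfl
    refine hasDerivAt_zero_of_abs_le_sq (K := K) ?_
    filter_upwards [Metric.closedBall_mem_nhds (0 : ℝ) one_pos] with x hx
    have hx' : |x| ≤ 1 := by simpa [Real.dist_eq] using hx
    rw [abs_rpow_eq hr, sub_zero, abs_mul, abs_mul, abs_of_nonneg (sq_nonneg x),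
      abs_of_nonneg (Real.rpow_nonneg (abs_nonneg x) _)]
    have := (hK r le_rfl le_rfl x hx').2
    nlinarith [sq_nonneg x]
  · have h1 := (hasDerivAt_abs_rpow s (by linarith : 1 < r)).mul (Real.hasDerivAt_log hs)
    refine h1.congr_deriv ?_
    rw [abs_rpow_eq hr]
    field_simp

/-- A derivative vanishing linearly at 0 leaves the weight |a| + |b| in the mean value bound. With
this weight the right side is integrable for a, b in L², which a plain Lipschitz bound would not
give on a space of infinite measure. -/
lemma abs_sub_le_of_abs_deriv_le {f f' : ℝ → ℝ} (hd : ∀ s, HasDerivAt f (f' s) s) {K M : ℝ} (hK0 : 0 ≤ K)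
    (hK : ∀ s, |s| ≤ M → |f' s| ≤ K * |s|) {a b : ℝ} (ha : |a| ≤ M) (hb : |b| ≤ M) :
    |f a - f b| ≤ K * (|a - b| * (|a| + |b|)) := by
  set m := max |a| |b| with hm
  have ham : a ∈ Icc (-m) m := abs_le.1 (le_max_left _ _)
  have hbm : b ∈ Icc (-m) m := abs_le.1 (le_max_right _ _)
  have h1 := (convex_Icc (-m) m).norm_image_sub_le_of_norm_hasDerivWithin_le
    (f := f) (f' := f') (C := K * m) (fun x _ => (hd x).hasDerivWithinAt)
    (fun x hx => by
      have h2 : |x| ≤ m := abs_le.2 hx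
      exact (hK x (h2.trans (max_le ha hb))).trans (mul_le_mul_of_nonneg_left h2 hK0)) hbm ham
  rw [Real.norm_eq_abs, Real.norm_eq_abs] at h1
  have h3 : m ≤ |a| + |b| := max_le (by linarith [abs_nonneg b]) (by linarith [abs_nonneg a])
  calc |f a - f b| ≤ K * m * |a - b| := h1
    _ = K * (|a - b| * m) := by ring
    _ ≤ _ := by gcongr

/-- Uniform bounds and Lipschitz estimates for the powers `|s|^r` and for `|s|^r log s`. -/
lemma exists_power_estimates {r₀ r₁ M : ℝ} (h0 : 2 < r₀) (hM : 1 ≤ M) :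
    ∃ K, 0 < K ∧ ∀ r, r₀ ≤ r → r ≤ r₁ →
      (∀ s, |s| ≤ M → |s| ^ r ≤ K * s ^ 2) ∧
      (∀ s, |s| ≤ M → |(|s| ^ r * Real.log s)| ≤ K * s ^ 2) ∧
      (∀ s, |s| ≤ M → |(|s| ^ (r - 2) * s)| ≤ K * |s|) ∧
      (∀ a b, |a| ≤ M → |b| ≤ M → |(|a| ^ r - |b| ^ r)| ≤ K * (|a - b| * (|a| + |b|))) ∧
      (∀ a b, |a| ≤ M → |b| ≤ M → |(|a| ^ r * Real.log a - |b| ^ r * Real.log b)|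
        ≤ K * (|a - b| * (|a| + |b|))) := by
  obtain ⟨K, hK1, hK⟩ := exists_rpow_bounds (r₁ := r₁) h0 hM
  refine ⟨(|r₁| + 1) * K, by positivity, fun r hr0 hr1 => ?_⟩
  have hr : 2 < r := by linarith
  have hr1' : r ≤ |r₁| := hr1.trans (le_abs_self _)
  have hKK : K ≤ (|r₁| + 1) * K := by nlinarith [abs_nonneg r₁]
  have key : ∀ s, |s| ≤ M → |(|s| ^ (r - 2) * s)| ≤ K * |s| := fun s hs => by
    rw [abs_mul, abs_of_nonneg (Real.rpow_nonneg (abs_nonneg s) _)]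
    exact mul_le_mul_of_nonneg_right (hK r hr0 hr1 s hs).1 (abs_nonneg _)
  refine ⟨fun s hs => ?_, fun s hs => ?_, fun s hs => ?_, fun a b ha hb => ?_, fun a b ha hb => ?_⟩
  · rw [abs_rpow_eq hr]
    exact mul_le_mul_of_nonneg_right ((hK r hr0 hr1 s hs).1.trans hKK) (sq_nonneg _)
  · rw [abs_rpow_eq hr, abs_mul, abs_mul, abs_of_nonneg (sq_nonneg s),
      abs_of_nonneg (Real.rpow_nonneg (abs_nonneg s) _), mul_right_comm]
    exact mul_le_mul_of_nonneg_right ((hK r hr0 hr1 s hs).2.trans hKK) (sq_nonneg _)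
  · exact (key s hs).trans (mul_le_mul_of_nonneg_right hKK (abs_nonneg _))
  · refine abs_sub_le_of_abs_deriv_le (fun s => hasDerivAt_abs_rpow s (by linarith : 1 < r))
      (by positivity) (fun s hs => ?_) ha hb
    rw [mul_assoc, abs_mul, abs_of_nonneg (by linarith : 0 ≤ r)]
    calc r * |(|s| ^ (r - 2) * s)| ≤ (|r₁| + 1) * (K * |s|) :=
          mul_le_mul (by linarith) (key s hs) (abs_nonneg _) (by positivity)
      _ = _ := by ring
  · refine abs_sub_le_of_abs_deriv_le (fun s => hasDerivAt_rpow_mul_log hr s)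
      (by positivity) (fun s hs => ?_) ha hb
    refine (abs_add_le _ _).trans ?_
    rw [abs_mul, abs_mul, abs_mul, abs_of_nonneg (by linarith : 0 ≤ r),
      abs_of_nonneg (Real.rpow_nonneg (abs_nonneg s) _)]
    have h1 : r * (|s| ^ (r - 2) * |Real.log s|) ≤ |r₁| * K :=
      mul_le_mul hr1' (hK r hr0 hr1 s hs).2 (by positivity) (abs_nonneg _)
    have h2 := mul_le_mul_of_nonneg_right h1 (abs_nonneg s)
    have h3 := key s hs
    nlinarith

lemma lipschitz_of_abs_deriv_le {f f' : ℝ → ℝ} {K M : ℝ} (hd : ∀ s, HasDerivAt f (f' s) s)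
    (hK : ∀ s, |s| ≤ M → |f' s| ≤ K) (a : ℝ) (ha : a ∈ Icc (-M) M) (b : ℝ) (hb : b ∈ Icc (-M) M) :
    |f a - f b| ≤ K * |a - b| := by
  simpa using (convex_Icc (-M) M).norm_image_sub_le_of_norm_hasDerivWithin_le
    (f := f) (f' := f') (C := K) (fun x _ => (hd x).hasDerivWithinAt)
    (fun x hx => hK x (abs_le.2 hx)) hb ha

/-- The derivative of `|s|^(r-2) s` for `r > 2`. -/
lemma hasDerivAt_abs_rpow_mul_self {r : ℝ} (hr : 2 < r) (s : ℝ) :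
    HasDerivAt (fun s : ℝ => |s| ^ (r - 2) * s) ((r - 1) * |s| ^ (r - 2)) s := by
  rcases eq_or_ne s 0 with rfl | hs
  · have h0 : (0 : ℝ) ^ (r - 2) = 0 := Real.zero_rpow (by linarith)
    rw [abs_zero, h0, mul_zero, hasDerivAt_iff_tendsto_slope]
    have h1 : Tendsto (fun s : ℝ => |s| ^ (r - 2)) (𝓝 0) (𝓝 0) := by
      have : Continuous (fun s : ℝ => |s| ^ (r - 2)) :=
        continuous_abs.rpow_const fun _ => Or.inr (by linarith)
      simpa [h0] using this.tendsto 0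
    refine (h1.mono_left nhdsWithin_le_nhds).congr' ?_
    filter_upwards [self_mem_nhdsWithin] with x hx
    have : x ≠ 0 := hx
    simp [slope_def_field, h0, this]
  · have hp : 0 < |s| := abs_pos.2 hs
    have h1 := ((hasDerivAt_abs hs).rpow_const (p := r - 2) (Or.inl hp.ne')).mul (hasDerivAt_id s)
    refine h1.congr_deriv ?_
    have h2 : |s| ^ (r - 2) = |s| ^ (r - 2 - 1) * |s| := by
      rw [Real.rpow_sub_one hp.ne']; field_simp
    have h3 : ((SignType.sign s : SignType) : ℝ) * s = |s| := sign_mul_self s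
    simp only [id]
    rw [h2]
    linear_combination (r - 2) * |s| ^ (r - 2 - 1) * h3

/-! ### Powers of bounded functions and the logarithmic Sobolev inequality -/

lemma InForm.rpow_mul_self {w : Space N → ℝ} (hw : InForm J w) {M : ℝ} (hM : ∀ x, |w x| ≤ M)
    {r : ℝ} (hr : 2 ≤ r) : InForm J (fun x => |w x| ^ (r - 2) * w x) := by
  have hM0 : 0 ≤ M := (abs_nonneg _).trans (hM 0)
  rcases hr.eq_or_lt with rfl | hr
  · simpa using hw
  refine hw.comp_of_abs_sub_le (ψ := fun s => |s| ^ (r - 2) * s) (K := (r - 1) * M ^ (r - 2))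
    (by fun_prop) (by simp) (fun x => abs_le.1 (hM x)) (S := Icc (-M) M)
    ⟨by linarith, hM0⟩ ?_
  refine lipschitz_of_abs_deriv_le (hasDerivAt_abs_rpow_mul_self hr) fun s hs => ?_
  rw [abs_mul, abs_of_nonneg (by linarith : 0 ≤ r - 1),
    abs_of_nonneg (Real.rpow_nonneg (abs_nonneg s) _)]
  exact mul_le_mul_of_nonneg_left (Real.rpow_le_rpow (abs_nonneg _) hs (by linarith)) (by linarith)

lemma InForm.abs_rpow {w : Space N → ℝ} (hw : InForm J w) {M : ℝ} (hM : ∀ x, |w x| ≤ M)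
    {r : ℝ} (hr : 1 < r) : InForm J (fun x => |w x| ^ r) := by
  have hM0 : 0 ≤ M := (abs_nonneg _).trans (hM 0)
  refine hw.comp_of_abs_sub_le (ψ := fun s => |s| ^ r) (K := r * M ^ (r - 1))
    (by fun_prop) (by simp [Real.zero_rpow (by linarith : r ≠ 0)])
    (fun x => abs_le.1 (hM x)) (S := Icc (-M) M) ⟨by linarith, hM0⟩ ?_
  refine lipschitz_of_abs_deriv_le (fun s => hasDerivAt_abs_rpow s hr) fun s hs => ?_
  rw [mul_assoc, abs_mul, abs_of_nonneg (by linarith : 0 ≤ r), abs_mul,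
    abs_of_nonneg (Real.rpow_nonneg (abs_nonneg s) _)]
  refine mul_le_mul_of_nonneg_left ?_ (by linarith)
  rcases eq_or_ne s 0 with rfl | hs0
  · simpa using Real.rpow_nonneg hM0 _
  · have : |s| ^ (r - 2) * |s| = |s| ^ (r - 1) := by
      rw [← Real.rpow_add_one (abs_pos.2 hs0).ne']; congr 1; ring
    rw [this]
    exact Real.rpow_le_rpow (abs_nonneg _) hs (by linarith)

/-- Integrability of the functions in the logarithmic Sobolev inequality for bounded `L²` data. -/
lemma integrable_powers {w : Space N → ℝ} (hw : MemLp w 2 volume) {M : ℝ} (hM : ∀ x, |w x| ≤ M)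
    {r : ℝ} (hr : 2 < r) :
    Integrable (fun x => |w x| ^ r) volume ∧ Integrable (fun x => |w x| ^ r * Real.log (w x)) volume := by
  obtain ⟨K, -, hK⟩ := exists_power_estimates (r₁ := r) hr (le_max_left 1 M)
  obtain ⟨h1, h2, -⟩ := hK r le_rfl le_rfl
  have hm := hw.1.aemeasurable
  constructor
  · refine (hw.integrable_sq.const_mul K).mono'
      (AEMeasurable.aestronglyMeasurable (by fun_prop)) (ae_of_all _ fun x => ?_)
    rw [Real.norm_eq_abs, abs_of_nonneg (Real.rpow_nonneg (abs_nonneg _) _)]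
    exact h1 _ ((hM x).trans (le_max_right _ _))
  · refine (hw.integrable_sq.const_mul K).mono'
      (AEMeasurable.aestronglyMeasurable (by fun_prop)) (ae_of_all _ fun x => ?_)
    exact h2 _ ((hM x).trans (le_max_right _ _))

/-- The logarithmic Sobolev inequality for bounded functions, in terms of real integrals. -/
lemma LogSobolev.real_inequality (hJ : IsLevyKernel J) {r C D : ℝ} (h : LogSobolev J r C D)
    (hr : 2 < r) {w : Space N → ℝ} (hw : InForm J w) {M : ℝ} (hM : ∀ x, |w x| ≤ M) :
    r * (∫ x, |w x| ^ r * Real.log (w x)) - (∫ x, |w x| ^ r) * Real.log (∫ x, |w x| ^ r)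
      ≤ C * (∫ x, |w x| ^ r) + D * energy J w (fun x => |w x| ^ (r - 2) * w x) := by
  obtain ⟨i1, i2⟩ := integrable_powers hw.1 hM hr
  have h1 := h.2 w hw.1.1 ((memEnergySpace_iff hJ).2 (hw.abs_rpow hM (by linarith)))
  have h2 : ∀ x, |(|w x| ^ r)| = |w x| ^ r := fun x =>
    abs_of_nonneg (Real.rpow_nonneg (abs_nonneg _) _)
  have h3 : ∀ x, |w x| ^ r * Real.log (|w x| ^ r) = r * (|w x| ^ r * Real.log (w x)) := fun x => by
    rcases eq_or_ne (w x) 0 with h0 | h0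
    · simp [h0, Real.zero_rpow (by linarith : r ≠ 0)]
    · rw [Real.log_rpow (abs_pos.2 h0), Real.log_abs]; ring
  rw [entropy, dirichletForm_eq hJ (hw.rpow_mul_self hM hr.le) hw] at h1
  simp only [h2, h3] at h1
  rw [extIntegral_eq_integral (i2.const_mul r), integral_const_mul] at h1
  have h4 : energy J (fun x => |w x| ^ (r - 2) * w x) w
      = energy J w (fun x => |w x| ^ (r - 2) * w x) := by
    rw [energy, energy]; congr 1; funext z; ring
  rw [h4] at h1
  exact_mod_cast h1

/-! ### Differentiation along an interpolated Euler step -/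

/-- Derivative of `|ω(t)|^{q(t)}` for an exponent `q > 2`. -/
lemma hasDerivAt_abs_rpow_var {ω q : ℝ → ℝ} {ω' q' t : ℝ} (hω : HasDerivAt ω ω' t)
    (hq : HasDerivAt q q' t) (h2 : 2 < q t) :
    HasDerivAt (fun t => |ω t| ^ q t)
      (q' * (|ω t| ^ q t * Real.log (ω t)) + q t * ((|ω t| ^ (q t - 2) * ω t) * ω')) t := by
  by_cases h0 : ω t = 0
  · have e : q' * (|ω t| ^ q t * Real.log (ω t)) + q t * ((|ω t| ^ (q t - 2) * ω t) * ω') = 0 := by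
      simp [h0]
    rw [e]
    -- At a zero of ω the exponential formula is unavailable. There ω is O(x - t) and the exponent
    -- stays above some r₀ > 2 nearby, so the power is O((x - t)²) and has derivative 0.
    obtain ⟨r₀, hr₀, hr₀'⟩ := exists_between h2
    obtain ⟨K, hK0, hK⟩ := exists_power_estimates (r₁ := q t + 1) hr₀ le_rfl
    obtain ⟨c, hc⟩ := hω.differentiableAt.isBigO_sub.bound
    refine hasDerivAt_zero_of_abs_le_sq (K := K * c ^ 2) ?_
    have h01 : |ω t| < 1 := by rw [h0, abs_zero]; exact one_pos
    have e1 : ∀ᶠ x in 𝓝 t, |ω x| ≤ 1 := hω.continuousAt.abs.tendsto.eventually (ge_mem_nhds h01)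
    have e2 := hq.continuousAt.tendsto.eventually (le_mem_nhds hr₀')
    have e3 := hq.continuousAt.tendsto.eventually (ge_mem_nhds (lt_add_one (q t)))
    filter_upwards [e1, e2, e3, hc] with x h1 h2 h3 h4
    rw [h0, sub_zero, Real.norm_eq_abs, Real.norm_eq_abs] at h4
    rw [abs_of_nonneg (Real.rpow_nonneg (abs_nonneg _) _)]
    refine ((hK _ h2 h3).1 _ h1).trans ?_
    rw [mul_assoc]
    refine mul_le_mul_of_nonneg_left ?_ hK0.le
    have := mul_self_le_mul_self (abs_nonneg _) h4
    rw [← sq_abs (ω x), ← sq_abs (x - t)]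
    nlinarith
  · have h1 : HasDerivAt (fun t => Real.exp (Real.log (ω t) * q t))
        (Real.exp (Real.log (ω t) * q t) * (ω' / ω t * q t + Real.log (ω t) * q')) t :=
      ((hω.log h0).mul hq).exp
    have h2 : ∀ x, ω x ≠ 0 → |ω x| ^ q x = Real.exp (Real.log (ω x) * q x) := fun x hx => by
      rw [Real.rpow_def_of_pos (abs_pos.2 hx), Real.log_abs]
    have h3 : ∀ᶠ x in 𝓝 t, ω x ≠ 0 := hω.continuousAt.eventually_ne h0
    refine (h1.congr_of_eventuallyEq (h3.mono h2)).congr_deriv ?_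
    rw [← h2 t h0, abs_rpow_eq ‹2 < q t›]
    field_simp
    ring

/-- Linear interpolation between the two ends of a time step `[s, s + h]`. -/
def interp (s h : ℝ) (f w : Space N → ℝ) (t : ℝ) (x : Space N) : ℝ :=
  f x + (t - s) / h * (w x - f x)

lemma hasDerivAt_interp (s h : ℝ) (f w : Space N → ℝ) (t : ℝ) (x : Space N) :
    HasDerivAt (fun t => interp s h f w t x) ((w x - f x) / h) t := by
  have := ((((hasDerivAt_id t).sub_const s).div_const h).mul_const (w x - f x)).const_add (f x)
  refine this.congr_deriv ?_
  ring

/-- The window extends beyond the step on both sides, making it a neighbourhood of every point of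
the closed step. Two-sided derivatives are thus available at the endpoints. -/
lemma abs_interp_le {s h t : ℝ} (hh : 0 < h) {f w : Space N → ℝ} (h1 : s - h ≤ t) (h2 : t ≤ s + 2 * h)
    (x : Space N) : |interp s h f w t x| ≤ 2 * (|f x| + |w x|) := by
  have e1 : -1 ≤ (t - s) / h := by rw [le_div_iff₀ hh]; linarith
  have e2 : (t - s) / h ≤ 2 := by rw [div_le_iff₀ hh]; linarith
  set θ := (t - s) / h
  have : interp s h f w t x = (1 - θ) * f x + θ * w x := by rw [interp]; ring
  rw [this]
  refine (abs_add_le _ _).trans ?_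
  rw [abs_mul, abs_mul, mul_add]
  gcongr <;> rw [abs_le] <;> constructor <;> linarith

lemma abs_interp_le_of_mem {s h t M : ℝ} (hh : 0 < h) {f w : Space N → ℝ} (h1 : s ≤ t)
    (h2 : t ≤ s + h) {x : Space N} (hf : |f x| ≤ M) (hw : |w x| ≤ M) :
    |interp s h f w t x| ≤ M := by
  have e1 : 0 ≤ (t - s) / h := div_nonneg (by linarith) hh.le
  have e2 : (t - s) / h ≤ 1 := by rw [div_le_one hh]; linarith
  set θ := (t - s) / h
  have : interp s h f w t x = (1 - θ) * f x + θ * w x := by rw [interp]; ring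
  rw [this]
  rw [abs_le] at *
  constructor <;> nlinarith

lemma memLp_interp {f w : Space N → ℝ} (hf : MemLp f 2 volume) (hw : MemLp w 2 volume)
    (s h t : ℝ) : MemLp (interp s h f w t) 2 volume :=
  hf.add ((hw.sub hf).const_mul ((t - s) / h))

/-- Differentiation of `∫ |ω(t)|^{q(t)}` along a linear interpolation. -/
lemma hasDerivAt_integral_interp {f w : Space N → ℝ} (hf : MemLp f 2 volume)
    (hw : MemLp w 2 volume) {M : ℝ} (hfM : ∀ x, |f x| ≤ M) (hwM : ∀ x, |w x| ≤ M)
    {s h t α β r₀ r₁ Q : ℝ} (hh : 0 < h) (h1 : s ≤ t) (h2 : t ≤ s + h) {q q' : ℝ → ℝ}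
    (ht : t ∈ Ioo α β) (hq : ∀ t ∈ Ioo α β, HasDerivAt q (q' t) t) (hr₀ : 2 < r₀)
    (hq0 : ∀ t ∈ Ioo α β, r₀ ≤ q t) (hq1 : ∀ t ∈ Ioo α β, q t ≤ r₁)
    (hQ : ∀ t ∈ Ioo α β, |q' t| ≤ Q) :
    HasDerivAt (fun t => ∫ x, |interp s h f w t x| ^ q t)
      (q' t * (∫ x, |interp s h f w t x| ^ q t * Real.log (interp s h f w t x))
        + q t * ((∫ x, (|interp s h f w t x| ^ (q t - 2) * interp s h f w t x) * (w x - f x)) / h))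
      t := by
  have hM0 : 0 ≤ M := (abs_nonneg _).trans (hfM 0)
  -- On the enlarged window the interpolant is bounded by 2(|f| + |w|) ≤ 4M. The added 1 meets the
  -- requirement that the bound be at least 1.
  obtain ⟨K, hK0, hK⟩ := exists_power_estimates (r₁ := r₁) (M := 4 * M + 1) hr₀ (by linarith)
  have hS : Ioo α β ∩ Ioo (s - h) (s + 2 * h) ∈ 𝓝 t :=
    inter_mem (isOpen_Ioo.mem_nhds ht) (Ioo_mem_nhds (by linarith) (by linarith))
  have hωb : ∀ x, ∀ τ ∈ Ioo α β ∩ Ioo (s - h) (s + 2 * h),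
      |interp s h f w τ x| ≤ 2 * (|f x| + |w x|) := fun x τ hτ =>
    abs_interp_le hh hτ.2.1.le hτ.2.2.le x
  have hωM : ∀ x, ∀ τ ∈ Ioo α β ∩ Ioo (s - h) (s + 2 * h),
      |interp s h f w τ x| ≤ 4 * M + 1 := fun x τ hτ => by
    have := hωb x τ hτ
    have := hfM x
    have := hwM x
    linarith
  have hmeas : ∀ τ, AEMeasurable (interp s h f w τ) volume := fun τ =>
    (memLp_interp hf hw s h τ).1.aemeasurable
  have hfm := hf.1.aemeasurable
  have hwm := hw.1.aemeasurable
  have htS := mem_of_mem_nhds hS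
  have hωt : MemLp (interp s h f w t) 2 volume := memLp_interp hf hw s h t
  have hwt : ∀ x, |interp s h f w t x| ≤ M := fun x =>
    abs_interp_le_of_mem hh h1 h2 (hfM x) (hwM x)
  have hqt : 2 < q t := hr₀.trans_le (hq0 t ht)
  obtain ⟨i1, i2⟩ := integrable_powers hωt hwt hqt
  have i3 : Integrable (fun x => (|interp s h f w t x| ^ (q t - 2) * interp s h f w t x)
      * (w x - f x)) volume := by
    refine MemLp.integrable_mul (p := 2) (q := 2) ?_ (hw.sub hf)
    refine hωt.of_le_mul (c := K) (AEMeasurable.aestronglyMeasurable (by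
      have := hmeas t; fun_prop)) (ae_of_all _ fun x => ?_)
    exact (hK _ (hq0 t ht) (hq1 t ht)).2.2.1 _ (hωM x t htS)
  have ibound : Integrable (fun x => (Q * K * 4 + |r₁| * K * 2 / h) * (|f x| + |w x|) ^ 2) volume :=
    (hf.abs.add hw.abs).integrable_sq.const_mul _
  have key := (hasDerivAt_integral_of_dominated_loc_of_deriv_le (μ := (volume : Measure (Space N)))
    (F := fun t x => |interp s h f w t x| ^ q t)
    (F' := fun t x => q' t * (|interp s h f w t x| ^ q t * Real.log (interp s h f w t x))
        + q t * ((|interp s h f w t x| ^ (q t - 2) * interp s h f w t x) * ((w x - f x) / h)))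
    (bound := fun x => (Q * K * 4 + |r₁| * K * 2 / h) * (|f x| + |w x|) ^ 2)
    hS (Eventually.of_forall fun τ => AEMeasurable.aestronglyMeasurable (by
      have := hmeas τ; fun_prop)) i1 (AEMeasurable.aestronglyMeasurable (by
      have := hmeas t; fun_prop)) (ae_of_all _ fun x τ hτ => ?_) ibound
    (ae_of_all _ fun x τ hτ => ?_)).2
  · refine key.congr_deriv ?_
    have e : ∀ x, q' t * (|interp s h f w t x| ^ q t * Real.log (interp s h f w t x))
        + q t * ((|interp s h f w t x| ^ (q t - 2) * interp s h f w t x) * ((w x - f x) / h))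
        = q' t * (|interp s h f w t x| ^ q t * Real.log (interp s h f w t x))
        + q t / h * ((|interp s h f w t x| ^ (q t - 2) * interp s h f w t x) * (w x - f x)) :=
      fun x => by ring
    simp_rw [e]
    rw [integral_add (i2.const_mul _) (i3.const_mul _), integral_const_mul, integral_const_mul]
    ring
  · obtain ⟨-, k2, k3, -⟩ := hK _ (hq0 τ hτ.1) (hq1 τ hτ.1)
    have hm := hωM x τ hτ
    have hb := hωb x τ hτ
    have hF : 0 ≤ |f x| + |w x| := by positivity
    have hω2 : interp s h f w τ x ^ 2 ≤ 4 * (|f x| + |w x|) ^ 2 := by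
      have := mul_self_le_mul_self (abs_nonneg _) hb
      rw [← sq_abs]; nlinarith
    have hQ0 : 0 ≤ Q := (abs_nonneg _).trans (hQ τ hτ.1)
    have hwf : |w x - f x| ≤ |f x| + |w x| := (abs_sub _ _).trans_eq (add_comm _ _)
    have hqa : |q τ| ≤ |r₁| := by
      rw [abs_of_nonneg (by linarith [hq0 τ hτ.1])]
      exact (hq1 τ hτ.1).trans (le_abs_self _)
    refine (norm_add_le _ _).trans ?_
    rw [add_mul]
    refine add_le_add ?_ ?_
    · rw [Real.norm_eq_abs, abs_mul]
      calc _ ≤ Q * (K * interp s h f w τ x ^ 2) :=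
            mul_le_mul (hQ τ hτ.1) (k2 _ hm) (abs_nonneg _) hQ0
        _ ≤ Q * (K * (4 * (|f x| + |w x|) ^ 2)) := by gcongr
        _ = _ := by ring
    · rw [Real.norm_eq_abs, abs_mul, abs_mul, abs_div, abs_of_pos hh]
      calc _ ≤ |r₁| * ((K * (2 * (|f x| + |w x|))) * ((|f x| + |w x|) / h)) := by
            gcongr
            exact (k3 _ hm).trans (by gcongr)
        _ = _ := by ring
  · exact hasDerivAt_abs_rpow_var (hasDerivAt_interp s h f w τ x) (hq τ hτ.1)
      (hr₀.trans_le (hq0 τ hτ.1))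

/-- Monotonicity of `|s|^(r-2) s`. -/
lemma monotone_abs_rpow_mul_self {r : ℝ} (hr : 2 < r) : Monotone (fun s : ℝ => |s| ^ (r - 2) * s) := by
  refine monotone_of_deriv_nonneg (fun s => (hasDerivAt_abs_rpow_mul_self hr s).differentiableAt)
    fun s => ?_
  rw [(hasDerivAt_abs_rpow_mul_self hr s).deriv]
  exact mul_nonneg (by linarith) (Real.rpow_nonneg (abs_nonneg _) _)

/-- The energy dissipated during one step. -/
lemma IsResolvent.integral_interp_le {h : ℝ} (hh : 0 < h) {f w : Space N → ℝ}
    (hw : IsResolvent J h f w) (hf : MemLp f 2 volume) {M : ℝ} (hfM : ∀ x, |f x| ≤ M)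
    (hwM : ∀ x, |w x| ≤ M) {s t r : ℝ} (h1 : s ≤ t) (h2 : t ≤ s + h) (hr : 2 < r) :
    (∫ x, (|interp s h f w t x| ^ (r - 2) * interp s h f w t x) * (w x - f x)) / h
      ≤ - energy J w (fun x => |w x| ^ (r - 2) * w x) := by
  obtain ⟨K, hK0, hK⟩ := exists_power_estimates (r₁ := r) hr (le_max_left 1 M)
  have hint : ∀ g : Space N → ℝ, MemLp g 2 volume → (∀ x, |g x| ≤ M) →
      Integrable (fun x => (|g x| ^ (r - 2) * g x) * (w x - f x)) volume := fun g hg hgM => by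
    refine MemLp.integrable_mul (p := 2) (q := 2) ?_ (hw.1.1.sub hf)
    have := hg.1.aemeasurable
    refine hg.of_le_mul (c := K) (AEMeasurable.aestronglyMeasurable (by fun_prop))
      (ae_of_all _ fun x => ?_)
    exact (hK _ le_rfl le_rfl).2.2.1 _ ((hgM x).trans (le_max_right _ _))
  have h3 := hw.2 _ (hw.1.rpow_mul_self hwM hr.le)
  have h4 : ∫ x, (w x - f x) * (|w x| ^ (r - 2) * w x) = ∫ x, (|w x| ^ (r - 2) * w x) * (w x - f x) := by
    congr 1; funext x; ring
  rw [h4] at h3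
  -- Pointwise the interpolant lies on the same side of w as f does, so monotonicity of φ(s) =
  -- |s|^{r-2}s gives (φ(ω) - φ(w))(w - f) ≤ 0.
  have h5 : ∫ x, (|interp s h f w t x| ^ (r - 2) * interp s h f w t x) * (w x - f x)
      ≤ ∫ x, (|w x| ^ (r - 2) * w x) * (w x - f x) := by
    refine integral_mono (hint _ (memLp_interp hf hw.1.1 s h t)
      fun x => abs_interp_le_of_mem hh h1 h2 (hfM x) (hwM x)) (hint w hw.1.1 hwM) fun x => ?_
    have e2 : (t - s) / h ≤ 1 := by rw [div_le_one hh]; linarith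
    simp only
    rcases le_total (f x) (w x) with hle | hle
    · refine mul_le_mul_of_nonneg_right ?_ (by linarith)
      refine monotone_abs_rpow_mul_self hr ?_
      simp only [interp]; nlinarith
    · refine mul_le_mul_of_nonpos_right ?_ (by linarith)
      refine monotone_abs_rpow_mul_self hr ?_
      simp only [interp]; nlinarith
  rw [div_le_iff₀ hh]
  linarith

/-! ### Growth of the logarithmic norm over one step -/

/-- A portion of an exponent curve `q' = q² / D(q)` with `2 < r₀ ≤ q ≤ r₁`, along which the
logarithmic Sobolev inequality holds with `D` bounded below. -/
structure IsExponentCurve (J : Space N → Space N → ℝ≥0) (C D q : ℝ → ℝ) (α β r₀ r₁ d : ℝ) :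
    Prop where
  two_lt : 2 < r₀
  d_pos : 0 < d
  hasDerivAt : ∀ t ∈ Ioo α β, HasDerivAt q (q t ^ 2 / D (q t)) t
  ge : ∀ t ∈ Ioo α β, r₀ ≤ q t
  le : ∀ t ∈ Ioo α β, q t ≤ r₁
  D_ge : ∀ t ∈ Ioo α β, d ≤ D (q t)
  logSobolev : ∀ t ∈ Ioo α β, LogSobolev J (q t) (C (q t)) (D (q t))

/-- Gross's computation reduced to real numbers: y and Z stand for the integrals of the interpolant
and of the right endpoint, and G for the derivative of y. The left side is the derivative of log y /
q when q' = q²/D. Since y ≥ b, the ratio Z/y is within e/b of 1, and every error is a multiple of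
that quantity. -/
lemma log_growth_le {y Z b e q r₁ D d C Λ G : ℝ} (hb : 0 < b) (hby : b ≤ y) (he : 0 ≤ e)
    (heb : e ≤ b / 2) (hZ : |Z - y| ≤ e) (hq : 0 < q) (hqr : q ≤ r₁) (hd : 0 < d) (hdD : d ≤ D)
    (hΛ : |Real.log y| ≤ Λ)
    (hG : G ≤ q ^ 2 / D * e + q / D * (Z * Real.log Z + C * Z)) :
    G / (q * y) - Real.log y / D ≤ C / D + e / b * ((r₁ + Λ + 2) / d + |C / D|) := by
  have hy : 0 < y := hb.trans_le hby
  have hD : 0 < D := hd.trans_le hdD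
  have hZ' := abs_le.1 hZ
  have hZpos : 0 < Z := by linarith
  set σ := e / b with hσ
  have hσ0 : 0 ≤ σ := div_nonneg he hb.le
  have hσ1 : σ ≤ 1 / 2 := by rw [hσ, div_le_iff₀ hb]; linarith
  have hey : e / y ≤ σ := div_le_div_of_nonneg_left he hb hby
  set u := Z / y with hu
  have hu0 : 0 < u := div_pos hZpos hy
  have hu1 : |u - 1| ≤ σ := by
    have : u - 1 = (Z - y) / y := by rw [hu]; field_simp
    rw [this, abs_div, abs_of_pos hy]
    exact (div_le_div_of_nonneg_right hZ hy.le).trans hey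
  have hu1' := abs_le.1 hu1
  have hlogZ : Real.log Z = Real.log y + Real.log u := by
    rw [← Real.log_mul hy.ne' hu0.ne', hu]; congr 1; field_simp
  -- Here u log u ≤ u(u - 1), and u ≤ 3/2 because σ ≤ 1/2.
  have hlogu : u * Real.log u ≤ 2 * σ := by
    have := Real.log_le_sub_one_of_pos hu0
    nlinarith
  have h1 : (u - 1) * Real.log y ≤ σ * Λ := by
    refine (le_abs_self _).trans ?_
    rw [abs_mul]; exact mul_le_mul hu1 hΛ (abs_nonneg _) hσ0
  have h2 : (u - 1) * C ≤ σ * |C| := by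
    refine (le_abs_self _).trans ?_
    rw [abs_mul]; exact mul_le_mul_of_nonneg_right hu1 (abs_nonneg _)
  have h3 : G / (q * y) ≤ q / D * (e / y) + 1 / D * (u * (Real.log y + Real.log u) + C * u) := by
    rw [← hlogZ, hu, div_le_iff₀ (mul_pos hq hy)]
    refine hG.trans_eq ?_
    field_simp
  have hΛ0 : 0 ≤ Λ := (abs_nonneg _).trans hΛ
  have h4 : q / D * (e / y) ≤ r₁ * σ / D := by
    rw [div_mul_eq_mul_div]
    exact div_le_div_of_nonneg_right (mul_le_mul hqr hey (by positivity) (by linarith)) hD.le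
  have h5 : 1 / D * (u * (Real.log y + Real.log u) + C * u) - Real.log y / D
      ≤ (C + σ * Λ + 2 * σ + σ * |C|) / D := by
    rw [one_div_mul_eq_div, ← sub_div]
    refine div_le_div_of_nonneg_right ?_ hD.le
    nlinarith
  have h6 : (r₁ + Λ + 2) * σ / D ≤ (r₁ + Λ + 2) * σ / d :=
    div_le_div_of_nonneg_left (by
      have : 0 ≤ r₁ := by linarith
      positivity) hd hdD
  rw [abs_div, abs_of_pos hD]
  have h7 : C / D + σ * ((r₁ + Λ + 2) / d + |C| / D)
      = (r₁ + Λ + 2) * σ / d + (C + σ * |C|) / D := by ring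
  have h8 : r₁ * σ / D + (C + σ * Λ + 2 * σ + σ * |C|) / D
      = (r₁ + Λ + 2) * σ / D + (C + σ * |C|) / D := by ring
  rw [h7]
  linarith

/-- Stability of integral functionals along the interpolation. -/
lemma abs_integral_interp_sub_le {f w : Space N → ℝ} (hf : MemLp f 2 volume)
    (hw : MemLp w 2 volume) {M K : ℝ} (hK0 : 0 ≤ K) (hfM : ∀ x, |f x| ≤ M) (hwM : ∀ x, |w x| ≤ M)
    {F : ℝ → ℝ} (hF : ∀ a b, |a| ≤ M → |b| ≤ M → |F a - F b| ≤ K * (|a - b| * (|a| + |b|)))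
    {s h t : ℝ} (hh : 0 < h) (h1 : s ≤ t) (h2 : t ≤ s + h)
    (i1 : Integrable (fun x => F (interp s h f w t x)) volume)
    (i2 : Integrable (fun x => F (w x)) volume) :
    |(∫ x, F (interp s h f w t x)) - ∫ x, F (w x)|
      ≤ 2 * K * ∫ x, |w x - f x| * (|f x| + |w x|) := by
  rw [← integral_sub i1 i2, ← integral_const_mul]
  have hint : Integrable (fun x => |w x - f x| * (|f x| + |w x|)) volume :=
    (hw.sub hf).abs.integrable_mul (hf.abs.add hw.abs)
  refine abs_integral_le_integral_abs.trans (integral_mono (i1.sub i2).abs (hint.const_mul _)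
    fun x => ?_)
  have hω := abs_interp_le_of_mem hh h1 h2 (hfM x) (hwM x)
  refine (hF _ _ hω (hwM x)).trans ?_
  have e1 : 0 ≤ (t - s) / h := div_nonneg (by linarith) hh.le
  have e2 : (t - s) / h ≤ 1 := by rw [div_le_one hh]; linarith
  have h3 : |interp s h f w t x - w x| ≤ |w x - f x| := by
    have : interp s h f w t x - w x = -((1 - (t - s) / h) * (w x - f x)) := by
      rw [interp]; ring
    rw [this, abs_neg, abs_mul, abs_of_nonneg (by linarith)]
    exact mul_le_of_le_one_left (abs_nonneg _) (by linarith)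
  have h4 : |interp s h f w t x| ≤ |f x| + |w x| :=
    abs_interp_le_of_mem hh h1 h2 (by linarith [abs_nonneg (w x)]) (by linarith [abs_nonneg (f x)])
  have h5 : |interp s h f w t x - w x| * (|interp s h f w t x| + |w x|)
      ≤ |w x - f x| * (2 * (|f x| + |w x|)) :=
    mul_le_mul h3 (by linarith [abs_nonneg (f x)]) (by positivity) (abs_nonneg _)
  calc _ ≤ K * (|w x - f x| * (2 * (|f x| + |w x|))) := mul_le_mul_of_nonneg_left h5 hK0
    _ = _ := by ring

lemma integral_interp_sq_le {f w : Space N → ℝ} (hf : MemLp f 2 volume)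
    (hw : MemLp w 2 volume) {s h t R : ℝ} (hh : 0 < h) (h1 : s ≤ t) (h2 : t ≤ s + h)
    (hfR : ∫ x, f x ^ 2 ≤ R) (hwR : ∫ x, w x ^ 2 ≤ R) :
    ∫ x, interp s h f w t x ^ 2 ≤ 2 * R := by
  have : ∫ x, interp s h f w t x ^ 2 ≤ ∫ x, (f x ^ 2 + w x ^ 2) := by
    refine integral_mono (memLp_interp hf hw s h t).integrable_sq
      (hf.integrable_sq.add hw.integrable_sq) fun x => ?_
    have e1 : 0 ≤ (t - s) / h := div_nonneg (by linarith) hh.le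
    have e2 : (t - s) / h ≤ 1 := by rw [div_le_one hh]; linarith
    simp only [interp]
    set θ := (t - s) / h
    nlinarith [mul_nonneg e1 (sub_nonneg.2 e2), sq_nonneg (w x - f x),
      mul_nonneg (mul_nonneg e1 (sub_nonneg.2 e2)) (sq_nonneg (w x - f x)),
      mul_nonneg e1 (sq_nonneg (f x)), mul_nonneg (sub_nonneg.2 e2) (sq_nonneg (w x))]
  rw [integral_add hf.integrable_sq hw.integrable_sq] at this
  linarith

/-- Growth of `log ‖ω(t)‖_{q(t)}` along one implicit Euler step, up to an error controlled by the
size of the step. -/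
lemma IsExponentCurve.exists_step_growth (hJ : IsLevyKernel J) {C D q : ℝ → ℝ}
    {α β r₀ r₁ d : ℝ} (hP : IsExponentCurve J C D q α β r₀ r₁ d) {b : ℝ} (hb : 0 < b) (R : ℝ)
    {M : ℝ} (hM : 0 ≤ M) :
    ∃ c > 0, ∃ δ₀ > 0, ∀ (f w : Space N → ℝ) (h s t δ : ℝ), 0 < h → s ≤ t → t ≤ s + h →
      t ∈ Ioo α β → MemLp f 2 volume → (∀ x, |f x| ≤ M) → (∀ x, |w x| ≤ M) →
      IsResolvent J h f w → ∫ x, f x ^ 2 ≤ R → ∫ x, w x ^ 2 ≤ R →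
      ∫ x, |w x - f x| * (|f x| + |w x|) ≤ δ → δ ≤ δ₀ →
      b ≤ ∫ x, |interp s h f w t x| ^ q t →
      ∃ l, HasDerivAt (fun t => Real.log (∫ x, |interp s h f w t x| ^ q t) / q t) l t ∧
        l ≤ C (q t) / D (q t) + c * δ * (1 + |C (q t) / D (q t)|) := by
  obtain ⟨K, hK0, hK⟩ := exists_power_estimates (r₁ := r₁) (M := M + 1) hP.two_lt (by linarith)
  -- Λ bounds |log y|, since b ≤ y ≤ K·2R. The threshold δ₀ = b/(4K) keeps the replacement error 2Kδ
  -- below b/2.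
  set Λ := |Real.log b| + |Real.log (K * (2 * R))| with hΛ
  refine ⟨2 * K / b * (1 + |(r₁ + Λ + 2) / d|), by positivity, b / (4 * K), by positivity, ?_⟩
  intro f w h s t δ hh hst hts ht hf hfM hwM hw hfR hwR hδ hδ₀ hby
  have hq2 : 2 < q t := hP.two_lt.trans_le (hP.ge t ht)
  obtain ⟨k1, k2, k3, k4, k5⟩ := hK _ (hP.ge t ht) (hP.le t ht)
  have hfM' : ∀ x, |f x| ≤ M + 1 := fun x => (hfM x).trans (by linarith)
  have hwM' : ∀ x, |w x| ≤ M + 1 := fun x => (hwM x).trans (by linarith)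
  have hωM' : ∀ x, |interp s h f w t x| ≤ M + 1 := fun x =>
    abs_interp_le_of_mem hh hst hts (hfM' x) (hwM' x)
  have hω := memLp_interp hf hw.1.1 s h t
  have hD : ∀ τ ∈ Ioo α β, 0 < D (q τ) := fun τ hτ => hP.d_pos.trans_le (hP.D_ge τ hτ)
  obtain ⟨i1, i2⟩ := integrable_powers hω hωM' hq2
  obtain ⟨i3, i4⟩ := integrable_powers hw.1.1 hwM' hq2
  have hder := hasDerivAt_integral_interp hf hw.1.1 hfM hwM (Q := r₁ ^ 2 / d) hh hst hts ht
    hP.hasDerivAt hP.two_lt hP.ge hP.le (fun τ hτ => by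
      have h0 : 0 < q τ := by linarith [hP.two_lt, hP.ge τ hτ]
      rw [abs_of_nonneg (div_nonneg (sq_nonneg _) (hD τ hτ).le)]
      exact div_le_div₀ (sq_nonneg _) (pow_le_pow_left₀ h0.le (hP.le τ hτ) 2) hP.d_pos
        (hP.D_ge τ hτ))
  have hdis := hw.integral_interp_le hh hf hfM hwM hst hts hq2
  have hLS := (hP.logSobolev t ht).real_inequality hJ hq2 hw.1 hwM
  have e1 := abs_integral_interp_sub_le hf hw.1.1 hK0.le hfM' hwM' k4 hh hst hts i1 i3
  have e2 := abs_integral_interp_sub_le hf hw.1.1 hK0.le hfM' hwM'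
    (F := fun a => |a| ^ q t * Real.log a) k5 hh hst hts i2 i4
  have hωR := integral_interp_sq_le hf hw.1.1 hh hst hts hfR hwR
  have hyK : ∫ x, |interp s h f w t x| ^ q t ≤ K * (2 * R) := by
    refine le_trans ?_ (mul_le_mul_of_nonneg_left hωR hK0.le)
    rw [← integral_const_mul]
    exact integral_mono i1 (hω.integrable_sq.const_mul _) fun x => k1 _ (hωM' x)
  set y := ∫ x, |interp s h f w t x| ^ q t with hy
  set Z := ∫ x, |w x| ^ q t with hZ
  set G₁ := ∫ x, |interp s h f w t x| ^ q t * Real.log (interp s h f w t x) with hG₁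
  set G₂ := ∫ x, |w x| ^ q t * Real.log (w x) with hG₂
  set E := energy J w (fun x => |w x| ^ (q t - 2) * w x) with hE
  set X := (∫ x, (|interp s h f w t x| ^ (q t - 2) * interp s h f w t x) * (w x - f x)) / h with hX
  have hypos : 0 < y := hb.trans_le hby
  have hDt := hD t ht
  have hqpos : 0 < q t := by linarith
  have hδ0 : 0 ≤ δ := le_trans (integral_nonneg fun x => by positivity) hδ
  have hKδ : 2 * K * ∫ x, |w x - f x| * (|f x| + |w x|) ≤ 2 * K * δ := by gcongr
  have hlogy : |Real.log y| ≤ Λ := by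
    have h1 := Real.log_le_log hb hby
    have h2 := Real.log_le_log hypos hyK
    rw [abs_le]
    constructor
    · linarith [neg_abs_le (Real.log b), abs_nonneg (Real.log (K * (2 * R)))]
    · linarith [le_abs_self (Real.log (K * (2 * R))), abs_nonneg (Real.log b)]
  -- The logarithmic integral is moved from the interpolant to w at cost 2Kδ. The logarithmic
  -- Sobolev inequality at w, multiplied by q/D, then produces an energy term qE that the
  -- dissipation cancels.
  have hG : q t ^ 2 / D (q t) * G₁ + q t * X
      ≤ q t ^ 2 / D (q t) * (2 * K * δ) + q t / D (q t) * (Z * Real.log Z + C (q t) * Z) := by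
    have h1 : G₁ - G₂ ≤ 2 * K * δ := (le_abs_self _).trans (e2.trans hKδ)
    have h2 : q t * X ≤ - (q t * E) := by
      rw [← mul_neg]; exact mul_le_mul_of_nonneg_left hdis hqpos.le
    have h3 : q t / D (q t) * (q t * G₂ - Z * Real.log Z) ≤
        q t / D (q t) * (C (q t) * Z + D (q t) * E) :=
      mul_le_mul_of_nonneg_left hLS (by positivity)
    have h4 : q t / D (q t) * (C (q t) * Z + D (q t) * E)
        = q t / D (q t) * (C (q t) * Z) + q t * E := by field_simp
    have h5 : q t ^ 2 / D (q t) * G₁ ≤ q t ^ 2 / D (q t) * (G₂ + 2 * K * δ) :=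
      mul_le_mul_of_nonneg_left (by linarith) (by positivity)
    have h6 : q t ^ 2 / D (q t) * (G₂ + 2 * K * δ)
        = q t ^ 2 / D (q t) * (2 * K * δ) + q t / D (q t) * (q t * G₂) := by ring
    rw [h4] at h3
    linarith
  have hgrow := log_growth_le (e := 2 * K * δ) hb hby (by positivity) (by
      rw [le_div_iff₀ (by positivity)] at hδ₀; linarith)
    (by rw [abs_sub_comm]; exact e1.trans hKδ) hqpos (hP.le t ht) hP.d_pos (hP.D_ge t ht) hlogy hG
  refine ⟨_, (hder.log hypos.ne').div (hP.hasDerivAt t ht) hqpos.ne', ?_⟩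
  refine le_trans (le_of_eq ?_) (hgrow.trans (add_le_add le_rfl ?_))
  · simp only [← hy]
    field_simp
  · have h1 : (r₁ + Λ + 2) / d + |C (q t) / D (q t)|
        ≤ (1 + |(r₁ + Λ + 2) / d|) * (1 + |C (q t) / D (q t)|) := by
      nlinarith [le_abs_self ((r₁ + Λ + 2) / d), abs_nonneg ((r₁ + Λ + 2) / d),
        abs_nonneg (C (q t) / D (q t)),
        mul_nonneg (abs_nonneg ((r₁ + Λ + 2) / d)) (abs_nonneg (C (q t) / D (q t)))]
    calc _ ≤ 2 * K * δ / b * ((1 + |(r₁ + Λ + 2) / d|) * (1 + |C (q t) / D (q t)|)) :=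
          mul_le_mul_of_nonneg_left h1 (by positivity)
      _ = _ := by ring

/-! ### Comparison principle and the bound for Euler chains -/

/-- A comparison principle: a growth bound that is only available above a positive threshold still
propagates any exponential bound lying above that threshold. -/
lemma le_exp_of_log_growth {y q Θ : ℝ → ℝ} {a s u l₀ b : ℝ} (has : a ≤ s) (hsu : s ≤ u)
    (hΘ : IntervalIntegrable Θ volume a u) (hy : ContinuousOn y (Icc s u))
    (hq : ContinuousOn q (Icc s u)) (hq0 : ∀ t ∈ Icc s u, 0 < q t) (hb : 0 < b)
    (hB : ∀ t ∈ Icc s u, b ≤ Real.exp (q t * (l₀ + ∫ τ in a..t, Θ τ)))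
    (hder : ∀ t ∈ Icc s u, b ≤ y t → ∃ l, HasDerivAt (fun t => Real.log (y t) / q t) l t ∧ l ≤ Θ t)
    (h0 : y s ≤ Real.exp (q s * (l₀ + ∫ τ in a..s, Θ τ))) :
    y u ≤ Real.exp (q u * (l₀ + ∫ τ in a..u, Θ τ)) := by
  by_contra! hcon
  set B : ℝ → ℝ := fun t => Real.exp (q t * (l₀ + ∫ τ in a..t, Θ τ)) with hBdef
  have hau : a ≤ u := has.trans hsu
  have hprim : ContinuousOn (fun t => ∫ τ in a..t, Θ τ) (Icc s u) := by
    have := intervalIntegral.continuousOn_primitive_interval'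
      (f := Θ) (a := a) (b₁ := a) (b₂ := u) hΘ left_mem_uIcc
    rw [uIcc_of_le hau] at this
    exact this.mono (Icc_subset_Icc_left has)
  have hBc : ContinuousOn B (Icc s u) := (hq.mul (continuousOn_const.add hprim)).rexp
  have hScl : IsClosed {t ∈ Icc s u | y t ≤ B t} := isClosed_Icc.isClosed_le hy hBc
  have hScomp : IsCompact {t ∈ Icc s u | y t ≤ B t} :=
    isCompact_Icc.of_isClosed_subset hScl fun t ht => ht.1
  -- Take the last time at which the bound holds. After it y exceeds B ≥ b, so the growth estimate
  -- is available up to u and its integral contradicts the failure at u.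
  obtain ⟨t₀, ht₀, hmax⟩ := hScomp.exists_isGreatest ⟨s, left_mem_Icc.2 hsu, h0⟩
  have ht₀u : t₀ < u := by
    refine lt_of_le_of_ne ht₀.1.2 fun h => ?_
    rw [h] at ht₀
    exact absurd ht₀.2 (not_le.2 hcon)
  have hgt : ∀ t ∈ Ioc t₀ u, B t < y t := fun t ht => by
    by_contra! h
    exact absurd (hmax ⟨⟨ht₀.1.1.trans ht.1.le, ht.2⟩, h⟩) (not_le.2 ht.1)
  have hsub : Icc t₀ u ⊆ Icc s u := Icc_subset_Icc_left ht₀.1.1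
  have hge₀ : B t₀ ≤ y t₀ := by
    have e1 : Tendsto y (𝓝[Ioc t₀ u] t₀) (𝓝 (y t₀)) :=
      (hy t₀ ht₀.1).mono_left (nhdsWithin_mono _ (Ioc_subset_Icc_self.trans hsub))
    have e2 : Tendsto B (𝓝[Ioc t₀ u] t₀) (𝓝 (B t₀)) :=
      (hBc t₀ ht₀.1).mono_left (nhdsWithin_mono _ (Ioc_subset_Icc_self.trans hsub))
    have : (𝓝[Ioc t₀ u] t₀).NeBot := by
      rw [nhdsWithin_Ioc_eq_nhdsGT ht₀u]; infer_instance
    refine le_of_tendsto_of_tendsto e2 e1 ?_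
    filter_upwards [self_mem_nhdsWithin] with t ht
    exact (hgt t ht).le
  have hby : ∀ t ∈ Icc t₀ u, b ≤ y t := fun t ht => by
    refine (hB t (hsub ht)).trans ?_
    rcases ht.1.eq_or_lt with h | h
    · rw [← h]; exact hge₀
    · exact (hgt t ⟨h, ht.2⟩).le
  have hder' : ∀ t, ∃ l, t ∈ Icc t₀ u →
      HasDerivAt (fun t => Real.log (y t) / q t) l t ∧ l ≤ Θ t := fun t => by
    by_cases ht : t ∈ Icc t₀ u
    · obtain ⟨l, hl⟩ := hder t (hsub ht) (hby t ht)
      exact ⟨l, fun _ => hl⟩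
    · exact ⟨0, fun h => absurd h ht⟩
  choose l hl using hder'
  have hΘi : IntegrableOn Θ (Icc t₀ u) volume := by
    rw [integrableOn_Icc_iff_integrableOn_Ioc]
    exact ((intervalIntegrable_iff_integrableOn_Ioc_of_le hau).1 hΘ).mono_set
      (Ioc_subset_Ioc_left (has.trans ht₀.1.1))
  have hmain := intervalIntegral.sub_le_integral_of_hasDeriv_right_of_le
    (g := fun t => Real.log (y t) / q t) (g' := l) (φ := Θ) ht₀u.le
    (fun t ht => (hl t ht).1.continuousAt.continuousWithinAt)
    (fun t ht => (hl t (Ioo_subset_Icc_self ht)).1.hasDerivWithinAt) hΘi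
    (fun t ht => (hl t (Ioo_subset_Icc_self ht)).2)
  have hqt := hq0 t₀ ht₀.1
  have hqu := hq0 u (right_mem_Icc.2 hsu)
  have h1 : Real.log (y t₀) / q t₀ ≤ l₀ + ∫ τ in a..t₀, Θ τ := by
    have h2 : Real.log (y t₀) ≤ q t₀ * (l₀ + ∫ τ in a..t₀, Θ τ) := by
      have := Real.log_le_log (hb.trans_le (hby t₀ (left_mem_Icc.2 ht₀u.le))) ht₀.2
      rwa [hBdef, Real.log_exp] at this
    rw [div_le_iff₀ hqt]; linarith
  have hi1 : IntervalIntegrable Θ volume a t₀ :=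
    hΘ.mono_set (by
      rw [uIcc_of_le hau, uIcc_of_le (has.trans ht₀.1.1)]; exact Icc_subset_Icc_right ht₀u.le)
  have hi2 : IntervalIntegrable Θ volume t₀ u :=
    hΘ.mono_set (by
      rw [uIcc_of_le hau, uIcc_of_le ht₀u.le]; exact Icc_subset_Icc_left (has.trans ht₀.1.1))
  have h3 := intervalIntegral.integral_add_adjacent_intervals hi1 hi2
  have h4 : Real.log (y u) / q u ≤ l₀ + ∫ τ in a..u, Θ τ := by linarith
  rw [div_le_iff₀ hqu] at h4
  have hyu : 0 < y u := hb.trans_le (hby u (right_mem_Icc.2 ht₀u.le))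
  have h5 := (Real.log_le_iff_le_exp hyu).1 h4
  rw [mul_comm] at h5
  exact absurd h5 (not_le.2 hcon)

lemma interp_left (s h : ℝ) (f w : Space N → ℝ) : interp s h f w s = f := by
  funext x; simp [interp]

lemma interp_right (s : ℝ) {h : ℝ} (hh : h ≠ 0) (f w : Space N → ℝ) :
    interp s h f w (s + h) = w := by
  funext x; simp [interp, hh]

/-- Young's inequality weighted by h: |w - f|(|f| + |w|) ≤ (w - f)²/(2h) + h(f² + w²). An L²
increment of order h thus yields an error of order h. -/
lemma integral_step_le {f w : Space N → ℝ} (hf : MemLp f 2 volume) (hw : MemLp w 2 volume)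
    {h k R : ℝ} (hh : 0 < h) (hk : ∫ x, (w x - f x) ^ 2 ≤ h ^ 2 * k)
    (hfR : ∫ x, f x ^ 2 ≤ R) (hwR : ∫ x, w x ^ 2 ≤ R) :
    ∫ x, |w x - f x| * (|f x| + |w x|) ≤ h * (k / 2 + 2 * R) := by
  have i1 : Integrable (fun x => (w x - f x) ^ 2) volume := (hw.sub hf).integrable_sq
  have i2 : Integrable (fun x => f x ^ 2 + w x ^ 2) volume := hf.integrable_sq.add hw.integrable_sq
  have h1 : ∫ x, |w x - f x| * (|f x| + |w x|)
      ≤ ∫ x, (1 / (2 * h) * (w x - f x) ^ 2 + h * (f x ^ 2 + w x ^ 2)) := by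
    refine integral_mono ((hw.sub hf).abs.integrable_mul (hf.abs.add hw.abs))
      ((i1.const_mul _).add (i2.const_mul _)) fun x => ?_
    simp only
    have e1 : 0 ≤ 1 / (2 * h) * (|w x - f x| - h * (|f x| + |w x|)) ^ 2 := by positivity
    have e2 : 1 / (2 * h) * (|w x - f x| - h * (|f x| + |w x|)) ^ 2
        = 1 / (2 * h) * (w x - f x) ^ 2 + h / 2 * (|f x| + |w x|) ^ 2
          - |w x - f x| * (|f x| + |w x|) := by
      rw [← sq_abs (w x - f x)]; field_simp; ring
    have e3 : h / 2 * (|f x| + |w x|) ^ 2 ≤ h * (f x ^ 2 + w x ^ 2) := by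
      rw [← sq_abs (f x), ← sq_abs (w x)]
      nlinarith [mul_nonneg hh.le (sq_nonneg (|f x| - |w x|))]
    linarith
  rw [integral_add (i1.const_mul _) (i2.const_mul _),
    integral_const_mul, integral_const_mul, integral_add hf.integrable_sq hw.integrable_sq] at h1
  have h2 : 1 / (2 * h) * ∫ x, (w x - f x) ^ 2 ≤ 1 / (2 * h) * (h ^ 2 * k) :=
    mul_le_mul_of_nonneg_left hk (by positivity)
  have h3 : 1 / (2 * h) * (h ^ 2 * k) = h * (k / 2) := by field_simp
  have h4 : h * ((∫ x, f x ^ 2) + ∫ x, w x ^ 2) ≤ h * (R + R) :=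
    mul_le_mul_of_nonneg_left (add_le_add hfR hwR) hh.le
  linarith

/-- Hypercontractive bound for the implicit Euler scheme with a small step. -/
theorem IsExponentCurve.euler_bound (hJ : IsLevyKernel J) {C D q : ℝ → ℝ}
    {α β r₀ r₁ d : ℝ} (hP : IsExponentCurve J C D q α β r₀ r₁ d) {a b : ℝ} (ha : α < a)
    (hab : a < b) (hbβ : b < β)
    (hΘ : IntervalIntegrable (fun t => C (q t) / D (q t)) volume a b)
    {M ε : ℝ} (hM : 0 ≤ M) (hε : 0 < ε) {f₀ w₀ : Space N → ℝ} (hf₀ : MemLp f₀ 2 volume)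
    (hw₀ : IsResolvent J ε f₀ w₀) {m : ℝ} (hm : 0 < m) (hm₀ : ∫ x, |w₀ x| ^ q a ≤ m ^ q a)
    {η : ℝ} (hη : 0 < η) :
    ∃ n₁ : ℕ, ∀ n : ℕ, n₁ ≤ n → 0 < n → ∀ W : ℕ → Space N → ℝ,
      IsEulerChain J ((b - a) / n) M W → W 0 = w₀ →
      ∫ x, |W n x| ^ q b ≤ (m * Real.exp ((∫ t in a..b, C (q t) / D (q t)) + η)) ^ q b := by
  have hba : 0 < b - a := sub_pos.2 hab
  have hmem : ∀ t ∈ Icc a b, t ∈ Ioo α β := fun t ht => ⟨ha.trans_le ht.1, ht.2.trans_lt hbβ⟩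
  have hqpos : ∀ t ∈ Icc a b, 0 < q t := fun t ht => by
    linarith [hP.two_lt, hP.ge t (hmem t ht)]
  set Θ : ℝ → ℝ := fun t => C (q t) / D (q t) with hΘdef
  set A := ∫ t in a..b, |Θ t| with hA
  set I := ∫ t in a..b, (1 + |Θ t|) with hI
  have hi1 : IntervalIntegrable (fun t => 1 + |Θ t|) volume a b :=
    intervalIntegrable_const.add hΘ.abs
  have hI0 : 0 ≤ I := intervalIntegral.integral_nonneg hab.le fun t _ => by positivity
  have hr₁ : 0 ≤ r₁ := by
    have := hP.le a (hmem a (left_mem_Icc.2 hab.le))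
    linarith [hqpos a (left_mem_Icc.2 hab.le)]
  -- This lies below every exponential bound to be propagated on [a,b], whatever the step size. The
  -- constants of the one-step estimate are therefore uniform over all steps and all chains.
  set b₀ := Real.exp (-(r₁ * (|Real.log m| + A))) with hb₀
  set R := ∫ x, w₀ x ^ 2 with hR
  have hR0 : 0 ≤ R := integral_nonneg fun x => sq_nonneg _
  obtain ⟨c, hc, δ₀, hδ₀, hstep⟩ := hP.exists_step_growth hJ (Real.exp_pos _ : 0 < b₀) R hM
  set k := (1 / ε) ^ 2 * ∫ x, (w₀ x - f₀ x) ^ 2 with hk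
  have hk0 : 0 ≤ k := mul_nonneg (by positivity) (integral_nonneg fun x => sq_nonneg _)
  set K := k / 2 + 2 * R with hK
  have hK0 : 0 ≤ K := by positivity
  -- The first entry makes the one-step error hK admissible. The second keeps its integral over
  -- [a,b], namely c h K I, below η.
  set h₀ := min (δ₀ / (K + 1)) (η / (c * K * I + 1)) with hh₀
  have hh₀pos : 0 < h₀ := lt_min (by positivity) (by positivity)
  obtain ⟨n₁, hn₁⟩ := exists_nat_gt ((b - a) / h₀)
  refine ⟨n₁, fun n hn hn0 W hW hW0 => ?_⟩
  have hnpos : (0 : ℝ) < n := Nat.cast_pos.2 hn0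
  set h := (b - a) / n with hh
  have hhpos : 0 < h := div_pos hba hnpos
  have hhh₀ : h ≤ h₀ := by
    rw [hh, div_le_iff₀ hnpos]
    rw [div_lt_iff₀ hh₀pos] at hn₁
    have : (n₁ : ℝ) ≤ n := Nat.cast_le.2 hn
    nlinarith
  have hnh : n * h = b - a := by rw [hh]; field_simp
  have hhδ : h * K ≤ δ₀ := by
    have := hhh₀.trans (min_le_left _ _)
    rw [le_div_iff₀ (by positivity)] at this
    linarith
  have hhη : c * (h * K) * I ≤ η := by
    have := hhh₀.trans (min_le_right _ _)
    rw [le_div_iff₀ (by positivity)] at this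
    linarith
  set κ := c * (h * K) with hκ
  have hκ0 : 0 ≤ κ := by positivity
  set Ψ : ℝ → ℝ := fun t => Θ t + κ * (1 + |Θ t|) with hΨ
  have hΨi : IntervalIntegrable Ψ volume a b := hΘ.add (hi1.const_mul κ)
  have hsubi : ∀ {g : ℝ → ℝ}, IntervalIntegrable g volume a b → ∀ t ∈ Icc a b,
      IntervalIntegrable g volume a t := fun hg t ht =>
    hg.mono_set (by rw [uIcc_of_le hab.le, uIcc_of_le ht.1]; exact Icc_subset_Icc_right ht.2)
  have hB : ∀ t ∈ Icc a b, b₀ ≤ Real.exp (q t * (Real.log m + ∫ τ in a..t, Ψ τ)) := by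
    intro t ht
    refine Real.exp_le_exp.2 ?_
    have e1 : ∫ τ in a..t, -|Θ τ| ≤ ∫ τ in a..t, Ψ τ :=
      intervalIntegral.integral_mono_on ht.1 (hsubi hΘ.abs t ht).neg (hsubi hΨi t ht)
        fun τ _ => by
          have := neg_abs_le (Θ τ)
          have : 0 ≤ κ * (1 + |Θ τ|) := by positivity
          simp only [hΨ]; linarith
    rw [intervalIntegral.integral_neg] at e1
    have e2 : ∫ τ in a..t, |Θ τ| ≤ A :=
      intervalIntegral.integral_mono_interval le_rfl ht.1 ht.2
        (ae_of_all _ fun τ => abs_nonneg _) hΘ.abs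
    have e3 : -(|Real.log m| + A) ≤ Real.log m + ∫ τ in a..t, Ψ τ := by
      linarith [neg_abs_le (Real.log m)]
    have hA0 : 0 ≤ |Real.log m| + A := add_nonneg (abs_nonneg _)
      (intervalIntegral.integral_nonneg hab.le fun t _ => abs_nonneg _)
    calc -(r₁ * (|Real.log m| + A)) ≤ -(q t * (|Real.log m| + A)) :=
          neg_le_neg (mul_le_mul_of_nonneg_right (hP.le t (hmem t ht)) hA0)
      _ = q t * -(|Real.log m| + A) := by ring
      _ ≤ _ := mul_le_mul_of_nonneg_left e3 (hqpos t ht).le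
  have hinc : ∀ j, ∫ x, (W (j + 1) x - W j x) ^ 2 ≤ h ^ 2 * k := fun j => by
    refine (hW.integral_sub_sq_le hhpos.le j).trans ?_
    refine (hW.integral_first_sub_sq_le hhpos.le hε hf₀ (hW0 ▸ hw₀)).trans_eq ?_
    rw [hW0, hk]; ring
  have hWR : ∀ j, ∫ x, W j x ^ 2 ≤ R := fun j => by
    have := hW.integral_sq_le hhpos.le j
    rwa [hW0] at this
  have key : ∀ j : ℕ, j ≤ n → ∫ x, |W j x| ^ q (a + j * h)
      ≤ Real.exp (q (a + j * h) * (Real.log m + ∫ τ in a..(a + j * h), Ψ τ)) := by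
    intro j
    induction j with
    | zero =>
      intro _
      simp only [Nat.cast_zero, zero_mul, add_zero, intervalIntegral.integral_same, hW0]
      rwa [mul_comm, ← Real.rpow_def_of_pos hm]
    | succ j ih =>
      intro hj
      have ih' := ih (Nat.le_of_succ_le hj)
      set s := a + j * h with hs
      have hu : a + (j + 1 : ℕ) * h = s + h := by rw [hs]; push_cast; ring
      have has : a ≤ s := by
        have := mul_nonneg (Nat.cast_nonneg (α := ℝ) j) hhpos.le
        linarith
      have hsb : s + h ≤ b := by
        have : ((j + 1 : ℕ) : ℝ) ≤ n := Nat.cast_le.2 hj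
        have := mul_le_mul_of_nonneg_right this hhpos.le
        linarith
      have hsub : ∀ t ∈ Icc s (s + h), t ∈ Icc a b := fun t ht =>
        ⟨has.trans ht.1, ht.2.trans hsb⟩
      rw [hu]
      have hfin := le_exp_of_log_growth (y := fun t => ∫ x, |interp s h (W j) (W (j + 1)) t x| ^ q t)
        (q := q) (Θ := Ψ) (l₀ := Real.log m) (b := b₀) has (by linarith : s ≤ s + h)
        (hsubi hΨi _ ⟨by linarith, hsb⟩) (fun t ht => ?_)
        (fun t ht => (hP.hasDerivAt t (hmem t (hsub t ht))).continuousAt.continuousWithinAt)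
        (fun t ht => hqpos t (hsub t ht)) (Real.exp_pos _) (fun t ht => hB t (hsub t ht))
        (fun t ht hbt => ?_) ?_
      · simpa only [interp_right s hhpos.ne'] using hfin
      · refine (hasDerivAt_integral_interp (hW.memLp j) (hW.memLp (j + 1)) (hW.bounded j)
          (hW.bounded (j + 1)) (Q := r₁ ^ 2 / d) hhpos ht.1 ht.2 (hmem t (hsub t ht))
          hP.hasDerivAt hP.two_lt hP.ge hP.le
          (fun τ hτ => ?_)).continuousAt.continuousWithinAt
        have h0 : 0 < q τ := by linarith [hP.two_lt, hP.ge τ hτ]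
        have hDτ := hP.d_pos.trans_le (hP.D_ge τ hτ)
        rw [abs_of_nonneg (div_nonneg (sq_nonneg _) hDτ.le)]
        exact div_le_div₀ (sq_nonneg _) (pow_le_pow_left₀ h0.le (hP.le τ hτ) 2) hP.d_pos
          (hP.D_ge τ hτ)
      · exact hstep (W j) (W (j + 1)) h s t (h * K) hhpos ht.1 ht.2 (hmem t (hsub t ht))
          (hW.memLp j) (hW.bounded j) (hW.bounded (j + 1)) (hW.step j) (hWR j) (hWR (j + 1))
          (integral_step_le (hW.memLp j) (hW.memLp (j + 1)) hhpos (hinc j) (hWR j) (hWR (j + 1)))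
          hhδ hbt
      · simpa only [interp_left] using ih'
  have hlast := key n le_rfl
  rw [hnh, add_sub_cancel] at hlast
  refine hlast.trans ?_
  rw [Real.rpow_def_of_pos (by positivity), Real.log_mul hm.ne' (Real.exp_pos _).ne', Real.log_exp]
  refine Real.exp_le_exp.2 ?_
  rw [mul_comm]
  refine mul_le_mul_of_nonneg_right ?_ (hqpos b (right_mem_Icc.2 hab.le)).le
  rw [hΨ, intervalIntegral.integral_add hΘ (hi1.const_mul κ), intervalIntegral.integral_const_mul]
  linarith

/-! ### The exponent function and the change of variables -/

/-- Existence of an exponent function for a continuous positive `D`. -/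
theorem exists_isExponent {D : ℝ → ℝ} {p : ℝ} (hp : 0 < p) (hD : ContinuousOn D (Ici p))
    (hpos : ∀ r, p ≤ r → 0 < D r) : ∃ (T : EReal) (q : ℝ → ℝ), IsExponent D p T q := by
  -- Separation of variables makes q the inverse of G(x) = ∫_p^x D(s)/s² ds. Freezing the integrand
  -- to the left of p makes G strictly increasing and C¹ on the whole line, so its inverse is
  -- differentiable even at 0; the supremum of G is the blow-up time.
  set g : ℝ → ℝ := fun x => D (max x p) / (max x p) ^ 2 with hg
  have hmax : Continuous fun x : ℝ => max x p := continuous_id.max continuous_const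
  have hmpos : ∀ x : ℝ, 0 < max x p := fun x => lt_max_of_lt_right hp
  have hgc : Continuous g :=
    (hD.comp_continuous hmax fun x => le_max_right x p).div (hmax.pow 2)
      fun x => (pow_pos (hmpos x) 2).ne'
  have hgpos : ∀ x, 0 < g x := fun x => div_pos (hpos _ (le_max_right x p)) (pow_pos (hmpos x) 2)
  set G : ℝ → ℝ := fun x => ∫ s in p..x, g s with hG
  have hGd : ∀ x, HasStrictDerivAt G (g x) x := fun x => hgc.integral_hasStrictDerivAt p x
  have hGmono : StrictMono G := strictMono_of_deriv_pos fun x => by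
    rw [(hGd x).hasDerivAt.deriv]; exact hgpos x
  have hGcont : Continuous G := continuous_iff_continuousAt.2 fun x => (hGd x).hasDerivAt.continuousAt
  have hGp : G p = 0 := intervalIntegral.integral_same
  set T : EReal := ⨆ x : ℝ, ((G x : ℝ) : EReal) with hT
  set q : ℝ → ℝ := Function.invFun G with hq
  have hqG : ∀ x, q (G x) = x := Function.leftInverse_invFun hGmono.injective
  have hlt : ∀ x, ((G x : ℝ) : EReal) < T := fun x =>
    lt_of_lt_of_le (EReal.coe_lt_coe_iff.2 (hGmono (lt_add_one x)))
      (le_iSup (fun x : ℝ => ((G x : ℝ) : EReal)) (x + 1))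
  have hsurj : ∀ t ∈ timeInterval T, ∃ x, p ≤ x ∧ G x = t := fun t ht => by
    obtain ⟨y, hy⟩ := lt_iSup_iff.1 ht.2
    have hy' : t < G y := EReal.coe_lt_coe_iff.1 hy
    have hpy : p ≤ y := by
      rw [← hGmono.le_iff_le, hGp]; exact ht.1.trans hy'.le
    obtain ⟨x, hx, hxt⟩ := intermediate_value_Icc hpy hGcont.continuousOn
      (⟨by rw [hGp]; exact ht.1, hy'.le⟩ : t ∈ Icc (G p) (G y))
    exact ⟨x, hx.1, hxt⟩
  refine ⟨T, q, ?_, ?_, fun t ht => ?_, fun t ht => ?_, ?_⟩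
  · have := hlt p
    rwa [hGp] at this
  · rw [← hGp, hqG]
  · obtain ⟨x, hx, rfl⟩ := hsurj t ht
    rw [hqG]; exact hx
  · obtain ⟨x, hx, rfl⟩ := hsurj t ht
    rw [hqG]
    have h1 := (hGd x).to_local_left_inverse (hgpos x).ne' (Eventually.of_forall hqG)
    have h3 : (g x)⁻¹ = x ^ 2 / D x := by
      rw [hg]; simp only [max_eq_left hx, inv_div]
    rw [← h3]
    exact h1.hasDerivAt.hasDerivWithinAt
  · refine tendsto_atTop.2 fun K => ?_
    rw [eventually_comap]
    have hmem : Ioo ((G (max K p) : ℝ) : EReal) T ∈ 𝓝[<] T := Ioo_mem_nhdsLT (hlt _)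
    filter_upwards [hmem] with y hy t hty
    subst hty
    have h0 : 0 ≤ t := by
      have h1 : G p ≤ G (max K p) := hGmono.monotone (le_max_right _ _)
      rw [hGp] at h1
      exact h1.trans (EReal.coe_lt_coe_iff.1 hy.1).le
    obtain ⟨x, hx, rfl⟩ := hsurj t ⟨h0, hy.2⟩
    rw [hqG]
    exact (le_max_left _ _).trans (hGmono.lt_iff_lt.1 (EReal.coe_lt_coe_iff.1 hy.1)).le

variable {D : ℝ → ℝ} {p : ℝ} {T : EReal} {q : ℝ → ℝ}

lemma zero_mem_timeInterval (hT : 0 < T) : (0 : ℝ) ∈ timeInterval T := ⟨le_rfl, by simpa using hT⟩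

lemma Icc_subset_timeInterval {t : ℝ} (ht : t ∈ timeInterval T) : Icc 0 t ⊆ timeInterval T :=
  fun _ hs => ⟨hs.1, (EReal.coe_le_coe_iff.2 hs.2).trans_lt ht.2⟩

lemma convex_timeInterval (T : EReal) : Convex ℝ (timeInterval T) := by
  refine OrdConnected.convex ⟨fun x hx y hy z hz => ⟨hx.1.trans hz.1, ?_⟩⟩
  exact (EReal.coe_le_coe_iff.2 hz.2).trans_lt hy.2

lemma timeInterval_mem_nhds {t : ℝ} (h0 : 0 < t) (ht : (t : EReal) < T) :
    timeInterval T ∈ 𝓝 t := by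
  obtain ⟨b, hb1, hb2⟩ := EReal.lt_iff_exists_real_btwn.1 ht
  have htb : t < b := EReal.coe_lt_coe_iff.1 hb1
  filter_upwards [Ioo_mem_nhds h0 htb] with s hs
  exact ⟨hs.1.le, (EReal.coe_lt_coe_iff.2 hs.2).trans hb2⟩

lemma IsExponent.continuousOn (h : IsExponent D p T q) : ContinuousOn q (timeInterval T) :=
  fun t ht => (h.ode t ht).continuousWithinAt

lemma IsExponent.strictMonoOn (h : IsExponent D p T q) (hp : 0 < p)
    (hpos : ∀ r, p ≤ r → 0 < D r) : StrictMonoOn q (timeInterval T) := by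
  refine strictMonoOn_of_deriv_pos (convex_timeInterval T) h.continuousOn fun t ht => ?_
  have htm := interior_subset ht
  rw [((h.ode t htm).hasDerivAt (mem_interior_iff_mem_nhds.1 ht)).deriv]
  exact div_pos (pow_pos (hp.trans_le (h.le t htm)) 2) (hpos _ (h.le t htm))

/-- Change of variables along the exponent function. -/
lemma IsExponent.change_of_variables (h : IsExponent D p T q) (hp : 0 < p)
    (hpos : ∀ r, p ≤ r → 0 < D r) {C : ℝ → ℝ} (hC : LocallyIntegrableOn C (Ici p) volume)
    {t : ℝ} (ht : t ∈ timeInterval T) :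
    IntervalIntegrable (fun s => C (q s) / D (q s)) volume 0 t ∧
      IntervalIntegrable (fun α => C α / α ^ 2) volume p (q t) ∧
      ∫ s in (0 : ℝ)..t, C (q s) / D (q s) = ∫ α in p..(q t), C α / α ^ 2 := by
  have hsub := Icc_subset_timeInterval ht
  have hmono := (h.strictMonoOn hp hpos).mono hsub
  have h0 : (0 : ℝ) ∈ Icc 0 t := left_mem_Icc.2 ht.1
  have htm : t ∈ Icc 0 t := right_mem_Icc.2 ht.1
  have hpq : p ≤ q t := h.le t ht
  have himg : q '' Icc 0 t = Icc p (q t) := by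
    refine Subset.antisymm ?_ ?_
    · rintro _ ⟨s, hs, rfl⟩
      exact ⟨h.le s (hsub hs), hmono.monotoneOn hs htm hs.2⟩
    · have := intermediate_value_Icc ht.1 (h.continuousOn.mono hsub)
      rwa [h.initial] at this
  have hd : ∀ s ∈ Icc 0 t, HasDerivWithinAt q (q s ^ 2 / D (q s)) (Icc 0 t) s := fun s hs =>
    (h.ode s (hsub hs)).mono hsub
  have hint : IntegrableOn (fun α => C α / α ^ 2) (Icc p (q t)) volume := by
    have h1 : IntegrableOn C (Icc p (q t)) volume :=
      hC.integrableOn_compact_subset Icc_subset_Ici_self isCompact_Icc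
    have h2 : ContinuousOn (fun α : ℝ => (α ^ 2)⁻¹) (Icc p (q t)) :=
      (continuousOn_id.pow 2).inv₀ fun x hx => (pow_pos (hp.trans_le hx.1) 2).ne'
    simpa only [div_eq_mul_inv] using h1.mul_continuousOn h2 isCompact_Icc
  have hEq : EqOn (fun s => |q s ^ 2 / D (q s)| • (C (q s) / q s ^ 2))
      (fun s => C (q s) / D (q s)) (Icc 0 t) := fun s hs => by
    have hq0 : 0 < q s := hp.trans_le (h.le s (hsub hs))
    have hD0 := hpos _ (h.le s (hsub hs))
    simp only [smul_eq_mul]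
    rw [abs_of_nonneg (by positivity)]
    field_simp
  -- The Jacobian turns C(α)/α² into C(q)/D(q). This form of the substitution needs no continuity of
  -- C, only injectivity and differentiability of q.
  have hint' := (integrableOn_image_iff_integrableOn_abs_deriv_smul measurableSet_Icc hd
    hmono.injOn (fun α => C α / α ^ 2)).1 (by rwa [himg])
  refine ⟨?_, ?_, ?_⟩
  · rw [intervalIntegrable_iff_integrableOn_Icc_of_le ht.1]
    exact hint'.congr_fun hEq measurableSet_Icc
  · rwa [intervalIntegrable_iff_integrableOn_Icc_of_le hpq]
  · rw [intervalIntegral.integral_of_le ht.1, intervalIntegral.integral_of_le hpq,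
      ← integral_Icc_eq_integral_Ioc, ← integral_Icc_eq_integral_Ioc, ← himg,
      integral_image_eq_integral_abs_deriv_smul measurableSet_Icc hd hmono.injOn]
    exact (setIntegral_congr_fun measurableSet_Icc hEq).symm

/-! ### Passage to the limit and contraction in Lebesgue spaces -/

/-- Lower semicontinuity of the norm of one Lebesgue space along convergence in another. -/
lemma eLpNorm_le_of_tendsto_eLpNorm {f : ℕ → Space N → ℝ} {g : Space N → ℝ} {r s : ℝ≥0∞}
    (hr : r ≠ 0) (hf : ∀ n, AEStronglyMeasurable (f n) volume) (hg : AEStronglyMeasurable g volume)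
    (hlim : Tendsto (fun n => eLpNorm (fun x => f n x - g x) r volume) atTop (𝓝 0))
    {c : ℕ → ℝ≥0∞} {c' : ℝ≥0∞} (hc : Tendsto c atTop (𝓝 c')) (hb : ∀ n, eLpNorm (f n) s volume ≤ c n) :
    eLpNorm g s volume ≤ c' := by
  obtain ⟨ns, hns, hae⟩ := (tendstoInMeasure_of_tendsto_eLpNorm hr hf hg hlim).exists_seq_tendsto_ae
  refine (Lp.eLpNorm_lim_le_liminf_eLpNorm (fun n => hf (ns n)) g hae).trans ?_
  have h1 : Tendsto (fun n => c (ns n)) atTop (𝓝 c') := hc.comp hns.tendsto_atTop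
  rw [← h1.liminf_eq]
  exact liminf_le_liminf (Eventually.of_forall fun n => hb (ns n))

lemma integrable_abs_rpow {w : Space N → ℝ} (hw : MemLp w 2 volume) {M : ℝ} (hM : ∀ x, |w x| ≤ M)
    {r : ℝ} (hr : 2 ≤ r) : Integrable (fun x => |w x| ^ r) volume := by
  rcases hr.eq_or_lt with rfl | hr
  · simpa using! hw.integrable_sq
  · exact (integrable_powers hw hM hr).1

/-- Young's inequality with exponents r and r/(r - 1), multiplied by r. It encodes the convexity of
|s|^r that makes the resolvent an L^r contraction. -/
lemma mul_le_young {r : ℝ} (hr : 2 ≤ r) (a b : ℝ) :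
    r * ((|b| ^ (r - 2) * b) * a) ≤ |a| ^ r + (r - 1) * |b| ^ r := by
  have hr1 : 1 < r := by linarith
  have hconj := Real.HolderConjugate.conjExponent hr1
  have h1 := Real.young_inequality_of_nonneg (abs_nonneg a)
    (Real.rpow_nonneg (abs_nonneg b) (r - 1)) hconj
  have h2 : (|b| ^ (r - 1)) ^ (Real.conjExponent r) = |b| ^ r := by
    rw [← Real.rpow_mul (abs_nonneg b), Real.conjExponent]
    congr 1
    field_simp [(by linarith : r - 1 ≠ 0)]
  rw [h2, Real.conjExponent] at h1
  have h3 : (|b| ^ (r - 2) * b) * a ≤ |a| * |b| ^ (r - 1) := by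
    refine (le_abs_self _).trans ?_
    rw [abs_mul, abs_mul, abs_of_nonneg (Real.rpow_nonneg (abs_nonneg b) _), mul_comm |a|]
    refine mul_le_mul_of_nonneg_right ?_ (abs_nonneg a)
    rcases eq_or_ne b 0 with rfl | hb
    · simpa using Real.rpow_nonneg le_rfl _
    · rw [← Real.rpow_add_one (abs_pos.2 hb).ne']
      refine le_of_eq ?_
      congr 1; ring
  have h4 : r * (|a| ^ r / r + |b| ^ r / (r / (r - 1))) = |a| ^ r + (r - 1) * |b| ^ r := by
    have : r - 1 ≠ 0 := by linarith
    field_simp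
  rw [← h4]
  exact mul_le_mul_of_nonneg_left (h3.trans h1) (by linarith)

/-- The resolvent contracts the `L^r` norm for `r ≥ 2`. -/
lemma IsResolvent.integral_rpow_le {h : ℝ} (hh : 0 ≤ h) {f w : Space N → ℝ}
    (hw : IsResolvent J h f w) (hf : MemLp f 2 volume) {M : ℝ} (hfM : ∀ x, |f x| ≤ M)
    (hwM : ∀ x, |w x| ≤ M) {r : ℝ} (hr : 2 ≤ r) :
    ∫ x, |w x| ^ r ≤ ∫ x, |f x| ^ r := by
  have hφ := hw.1.rpow_mul_self hwM hr
  have h1 := hw.2 _ hφ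
  have hpos : 0 ≤ energy J w (fun x => |w x| ^ (r - 2) * w x) := by
    refine integral_nonneg fun z => ?_
    have hmono : Monotone (fun s : ℝ => |s| ^ (r - 2) * s) := by
      rcases hr.eq_or_lt with rfl | hr'
      · simpa using! monotone_id
      · exact monotone_abs_rpow_mul_self hr'
    simp only [diff, Pi.zero_apply]
    rcases le_total (w z.2) (w z.1) with hle | hle
    · exact mul_nonneg (by linarith) (sub_nonneg.2 (hmono hle))
    · exact mul_nonneg_of_nonpos_of_nonpos (by linarith) (sub_nonpos.2 (hmono hle))
  have i1 := integrable_abs_rpow hw.1.1 hwM hr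
  have i2 := integrable_abs_rpow hf hfM hr
  have i3 : Integrable (fun x => (w x - f x) * (|w x| ^ (r - 2) * w x)) volume :=
    (hw.1.1.sub hf).integrable_mul hφ.1
  have h2 : ∫ x, (|w x| ^ r - |f x| ^ r) ≤ ∫ x, r * ((w x - f x) * (|w x| ^ (r - 2) * w x)) := by
    refine integral_mono (i1.sub i2) (i3.const_mul r) fun x => ?_
    have h3 := mul_le_young hr (f x) (w x)
    have h4 : |w x| ^ r = |w x| ^ (r - 2) * w x * w x := by
      rcases hr.eq_or_lt with rfl | hr'
      · simp [pow_two]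
      · rw [abs_rpow_eq hr']; ring
    simp only
    rw [h4] at h3 ⊢
    linarith
  rw [integral_sub i1 i2, integral_const_mul] at h2
  have h3 : r * ∫ x, (w x - f x) * (|w x| ^ (r - 2) * w x) ≤ 0 :=
    mul_nonpos_of_nonneg_of_nonpos (by linarith) (by linarith [mul_nonneg hh hpos])
  linarith

lemma integral_rpow_le_toReal {r : ℝ} (hr : 0 < r) {f g : Space N → ℝ}
    (hg : MemLp g (ENNReal.ofReal r) volume) (hfg : ∀ x, |f x| ≤ |g x|)
    (hf : Integrable (fun x => |f x| ^ r) volume) :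
    ∫ x, |f x| ^ r ≤ (eLpNorm g (ENNReal.ofReal r) volume).toReal ^ r := by
  have h0 : ENNReal.ofReal r ≠ 0 := (ENNReal.ofReal_pos.2 hr).ne'
  have hi := hg.integrable_norm_rpow h0 ENNReal.ofReal_ne_top
  rw [hg.eLpNorm_eq_integral_rpow_norm h0 ENNReal.ofReal_ne_top]
  rw [ENNReal.toReal_ofReal hr.le] at *
  have hnn : 0 ≤ ∫ x, ‖g x‖ ^ r := integral_nonneg fun x => by positivity
  rw [ENNReal.toReal_ofReal (Real.rpow_nonneg hnn _), ← Real.rpow_mul hnn, inv_mul_cancel₀ hr.ne',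
    Real.rpow_one]
  exact integral_mono hf hi fun x => Real.rpow_le_rpow (abs_nonneg _) (hfg x) hr.le

lemma eLpNorm_le_of_integral_rpow_le {r : ℝ} (hr : 0 < r) {w : Space N → ℝ}
    (hw : AEStronglyMeasurable w volume) (hi : Integrable (fun x => |w x| ^ r) volume) {c : ℝ}
    (hc : 0 ≤ c) (h : ∫ x, |w x| ^ r ≤ c ^ r) :
    eLpNorm w (ENNReal.ofReal r) volume ≤ ENNReal.ofReal c := by
  have h0 : ENNReal.ofReal r ≠ 0 := (ENNReal.ofReal_pos.2 hr).ne'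
  have hm : MemLp w (ENNReal.ofReal r) volume := by
    rw [← integrable_norm_rpow_iff hw h0 ENNReal.ofReal_ne_top, ENNReal.toReal_ofReal hr.le]
    exact hi
  rw [hm.eLpNorm_eq_integral_rpow_norm h0 ENNReal.ofReal_ne_top, ENNReal.toReal_ofReal hr.le]
  refine ENNReal.ofReal_le_ofReal ?_
  have hnn : 0 ≤ ∫ x, ‖w x‖ ^ r := integral_nonneg fun x => by positivity
  calc (∫ x, ‖w x‖ ^ r) ^ r⁻¹ ≤ (c ^ r) ^ r⁻¹ := Real.rpow_le_rpow hnn h (by positivity)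
    _ = c := Real.rpow_rpow_inv hc hr.ne'

variable {C : ℝ → ℝ}

/-- Starting at α > 0 gives q(α) > q(0) = p ≥ 2, so the strict inequality needed for the power
estimates holds even when p = 2. The lower bound d is the minimum of D on the compact interval [p,
q(β)]. -/
lemma IsExponent.isExponentCurve (h : IsExponent D p T q) (hp : 2 ≤ p)
    (hD : ContinuousOn D (Ici p)) (hLS : ∀ r, p ≤ r → LogSobolev J r (C r) (D r))
    {α β : ℝ} (hα : 0 < α) (hαβ : α < β) (hβ : (β : EReal) < T) :
    ∃ d, IsExponentCurve J C D q α β (q α) (q β) d := by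
  have hp0 : 0 < p := by linarith
  have hpos : ∀ r, p ≤ r → 0 < D r := fun r hr => (hLS r hr).1
  have hmono := h.strictMonoOn hp0 hpos
  have hβm : β ∈ timeInterval T := ⟨(hα.trans hαβ).le, hβ⟩
  have hαm : α ∈ timeInterval T := Icc_subset_timeInterval hβm ⟨hα.le, hαβ.le⟩
  have h0m : (0 : ℝ) ∈ timeInterval T := zero_mem_timeInterval h.pos
  have hmem : ∀ t ∈ Ioo α β, t ∈ timeInterval T := fun t ht =>
    Icc_subset_timeInterval hβm ⟨(hα.trans ht.1).le, ht.2.le⟩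
  obtain ⟨x, hx, hmin⟩ := isCompact_Icc.exists_isMinOn (nonempty_Icc.2 (h.le β hβm))
    (hD.mono (Icc_subset_Ici_self : Icc p (q β) ⊆ Ici p))
  refine ⟨D x, ?_, hpos x hx.1, fun t ht => ?_, fun t ht => ?_, fun t ht => ?_, fun t ht => ?_,
    fun t ht => hLS _ (h.le t (hmem t ht))⟩
  · have := hmono h0m hαm hα
    rw [h.initial] at this
    linarith
  · exact (h.ode t (hmem t ht)).hasDerivAt
      (timeInterval_mem_nhds (hα.trans ht.1) (hmem t ht).2)
  · exact hmono.monotoneOn hαm (hmem t ht) ht.1.le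
  · exact hmono.monotoneOn (hmem t ht) hβm ht.2.le
  · exact hmin ⟨h.le t (hmem t ht), hmono.monotoneOn (hmem t ht) hβm ht.2.le⟩

/-! ### The hypercontractive estimate -/

/-- Bounded approximations of a mild solution that satisfy the hypercontractive estimate up to an
arbitrarily small error. -/
lemma IsMildSolution.exists_approximation (hJ : IsLevyKernel J) (h : IsExponent D p T q)
    (hp : 2 ≤ p) (hC : LocallyIntegrableOn C (Ici p) volume) (hD : ContinuousOn D (Ici p))
    (hLS : ∀ r, p ≤ r → LogSobolev J r (C r) (D r))
    {v : ℝ → Lp ℝ 2 (volume : Measure (Space N))} (hv : IsMildSolution J v)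
    (hv0 : MemLp (v 0) (ENNReal.ofReal p) volume) {t : ℝ} (ht0 : 0 < t) (htT : (t : EReal) < T)
    {η : ℝ} (hη : 0 < η) :
    ∃ w : Space N → ℝ, AEStronglyMeasurable w volume ∧
      eLpNorm (fun x => w x - v t x) 2 volume ≤ ENNReal.ofReal η ∧
      eLpNorm w (ENNReal.ofReal (q t)) volume ≤
        ENNReal.ofReal (((eLpNorm (v 0) (ENNReal.ofReal p) volume).toReal + η) *
          Real.exp ((∫ s in (0 : ℝ)..t, C (q s) / D (q s)) + 2 * η)) := by
  have hp0 : 0 < p := by linarith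
  have hpos : ∀ r, p ≤ r → 0 < D r := fun r hr => (hLS r hr).1
  have htm : t ∈ timeInterval T := ⟨ht0.le, htT⟩
  have h0m : (0 : ℝ) ∈ timeInterval T := zero_mem_timeInterval h.pos
  obtain ⟨hΘ, -, -⟩ := h.change_of_variables hp0 hpos hC htm
  set S := (eLpNorm (v 0) (ENNReal.ofReal p) volume).toReal with hS
  have hS0 : 0 ≤ S := ENNReal.toReal_nonneg
  have hη4 : 0 < η / 4 := by positivity
  -- The regular datum is fixed before the starting time a, so that a may be taken small depending
  -- on the bound M.
  obtain ⟨M, ε, w₀, hε, hM, hw₀m, hw₀b, hw₀, hw₀v⟩ := hv.exists_regular_datum hJ hη4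
  have hf₀ : MemLp (fun x => clamp M (v 0 x)) 2 volume :=
    (Lp.memLp (v 0)).of_le (((measurable_clamp M).comp_aemeasurable
      (Lp.memLp (v 0)).1.aemeasurable).aestronglyMeasurable)
      (ae_of_all _ fun x => abs_clamp_le_abs hM _)
  have hf₀b : ∀ x, |clamp M (v 0 x)| ≤ M := fun x => abs_clamp_le hM _
  have hw₀S : ∫ x, |w₀ x| ^ p ≤ S ^ p :=
    (hw₀.integral_rpow_le hε.le hf₀ hf₀b hw₀b hp).trans
      (integral_rpow_le_toReal hp0 hv0 (fun x => abs_clamp_le_abs hM _)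
        (integrable_abs_rpow hf₀ hf₀b hp))
  have hIcc : Icc 0 t ∈ 𝓝[>] (0 : ℝ) := mem_of_superset (Ioo_mem_nhdsGT ht0) Ioo_subset_Icc_self
  have hqlim : Tendsto q (𝓝[>] 0) (𝓝 p) := by
    have h1 := h.continuousOn 0 h0m
    rw [ContinuousWithinAt, h.initial] at h1
    refine h1.mono_left (nhdsWithin_le_of_mem ?_)
    exact mem_of_superset hIcc (Icc_subset_timeInterval htm)
  have ev1 : ∀ᶠ a in 𝓝[>] (0 : ℝ), ‖v a - v 0‖ < η / 4 := by
    have h1 : Tendsto v (𝓝[>] 0) (𝓝 (v 0)) :=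
      (hv.continuousOn 0 self_mem_Ici).mono_left (nhdsWithin_mono _ Ioi_subset_Ici_self)
    filter_upwards [h1.eventually (Metric.ball_mem_nhds _ hη4)] with a ha
    rwa [← dist_eq_norm]
  -- Since |w₀| ≤ M, the q(a)-th power integral of w₀ is at most S^p (M + 1)^{q(a) - p}. As q(a) → p
  -- this tends to S^p < (S + η)^p.
  have ev2 : ∀ᶠ a in 𝓝[>] (0 : ℝ), S ^ p * (M + 1) ^ (q a - p) < (S + η) ^ q a := by
    have l1 : Tendsto (fun a => S ^ p * (M + 1) ^ (q a - p)) (𝓝[>] 0) (𝓝 (S ^ p * 1)) := by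
      refine Tendsto.const_mul _ ?_
      have : Tendsto (fun a => (M + 1) ^ (q a - p)) (𝓝[>] 0) (𝓝 ((M + 1) ^ (p - p))) :=
        (Real.continuousAt_const_rpow (by linarith : M + 1 ≠ 0)).tendsto.comp (hqlim.sub_const p)
      simpa using this
    have l2 : Tendsto (fun a => (S + η) ^ q a) (𝓝[>] 0) (𝓝 ((S + η) ^ p)) :=
      (Real.continuousAt_const_rpow (by linarith : S + η ≠ 0)).tendsto.comp hqlim
    refine l1.eventually_lt l2 ?_
    rw [mul_one]
    exact Real.rpow_lt_rpow hS0 (by linarith) hp0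
  -- C may be negative, so dropping [0,a] can enlarge the time integral. This accounts for one η in
  -- the exponent, and the Euler bound for the other.
  have ev3 : ∀ᶠ a in 𝓝[>] (0 : ℝ), -η < ∫ s in (0 : ℝ)..a, C (q s) / D (q s) := by
    have h1 := intervalIntegral.continuousOn_primitive_interval' hΘ left_mem_uIcc 0 left_mem_uIcc
    rw [uIcc_of_le ht0.le, ContinuousWithinAt, intervalIntegral.integral_same] at h1
    exact (h1.mono_left (nhdsWithin_le_of_mem hIcc)).eventually (lt_mem_nhds (by linarith))
  have ev4 : ∀ᶠ a in 𝓝[>] (0 : ℝ), a ∈ Ioo 0 t := Ioo_mem_nhdsGT ht0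
  obtain ⟨a, ⟨⟨⟨ha1, ha2⟩, ha3⟩, ha0, hat⟩⟩ := (((ev1.and ev2).and ev3).and ev4).exists
  obtain ⟨β, hβ1, hβ2⟩ := EReal.lt_iff_exists_real_btwn.1 htT
  have htβ : t < β := EReal.coe_lt_coe_iff.1 hβ1
  -- The curve is taken on (a/2, β) with β > t, so that [a,t] lies inside an open interval of
  -- differentiability.
  obtain ⟨d, hP⟩ := h.isExponentCurve (J := J) (C := C) hp hD hLS (half_pos ha0)
    (by linarith : a / 2 < β) hβ2
  have ham : a ∈ timeInterval T := Icc_subset_timeInterval htm ⟨ha0.le, hat.le⟩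
  have hqa : 2 < q a := hP.two_lt.trans_le (hP.ge a ⟨by linarith, by linarith⟩)
  have hqt : 2 < q t := hP.two_lt.trans_le (hP.ge t ⟨by linarith, by linarith⟩)
  have hpa : p ≤ q a := h.le a ham
  have hm₀ : ∫ x, |w₀ x| ^ q a ≤ (S + η) ^ q a := by
    refine le_trans ?_ ha2.le
    have h1 : ∫ x, |w₀ x| ^ q a ≤ ∫ x, |w₀ x| ^ p * (M + 1) ^ (q a - p) := by
      refine integral_mono (integrable_abs_rpow hw₀.1.1 hw₀b hqa.le)
        ((integrable_abs_rpow hw₀.1.1 hw₀b hp).mul_const _) fun x => ?_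
      have h2 : |w₀ x| ^ q a = |w₀ x| ^ p * |w₀ x| ^ (q a - p) := by
        rw [← Real.rpow_add_of_nonneg (abs_nonneg _) hp0.le (by linarith)]
        congr 1; ring
      simp only
      rw [h2]
      refine mul_le_mul_of_nonneg_left ?_ (Real.rpow_nonneg (abs_nonneg _) _)
      exact Real.rpow_le_rpow (abs_nonneg _) ((hw₀b x).trans (by linarith)) (by linarith)
    rw [integral_mul_const] at h1
    exact h1.trans (mul_le_mul_of_nonneg_right hw₀S (Real.rpow_nonneg (by linarith) _))
  have hi0 : IntervalIntegrable (fun s => C (q s) / D (q s)) volume 0 a :=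
    hΘ.mono_set (by rw [uIcc_of_le ha0.le, uIcc_of_le ht0.le]; exact Icc_subset_Icc_right hat.le)
  have hia : IntervalIntegrable (fun s => C (q s) / D (q s)) volume a t :=
    hΘ.mono_set (by rw [uIcc_of_le hat.le, uIcc_of_le ht0.le]; exact Icc_subset_Icc_left ha0.le)
  have hadd := intervalIntegral.integral_add_adjacent_intervals hi0 hia
  obtain ⟨n₀, hn₀⟩ := hv.euler_converges hJ ha0 hat hη4
  obtain ⟨n₁, hn₁⟩ := hP.euler_bound hJ (by linarith : a / 2 < a) hat htβ hia hM hε hf₀ hw₀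
    (by linarith : 0 < S + η) hm₀ hη
  set n := max n₀ n₁ + 1 with hn
  have hnpos : 0 < n := Nat.succ_pos _
  have hstep : 0 < (t - a) / n := div_pos (by linarith) (Nat.cast_pos.2 hnpos)
  obtain ⟨W, hW0, hW⟩ := exists_isEulerChain (J := J) hstep hw₀m hw₀b hw₀.1.1
  have hconv := hn₀ n ((le_max_left _ _).trans (Nat.le_succ _)) hnpos M W hW
  have hbound := hn₁ n ((le_max_right _ _).trans (Nat.le_succ _)) hnpos W hW hW0
  refine ⟨W n, (hW.memLp n).1, ?_, ?_⟩
  · refine hconv.trans ?_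
    rw [hW0]
    have h1 := eLpNorm_sub_le_add hw₀.1.1 (Lp.memLp (v 0)) (Lp.memLp (v a))
    rw [eLpNorm_Lp_sub_eq, norm_sub_rev] at h1
    have h2 : eLpNorm (fun x => w₀ x - v a x) 2 volume
        ≤ ENNReal.ofReal (η / 4) + ENNReal.ofReal (η / 4) :=
      h1.trans (add_le_add hw₀v (ENNReal.ofReal_le_ofReal ha1.le))
    refine (add_le_add h2 le_rfl).trans ?_
    rw [← ENNReal.ofReal_add hη4.le hη4.le, ← ENNReal.ofReal_add (by positivity) hη4.le]
    exact ENNReal.ofReal_le_ofReal (by linarith)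
  · refine (eLpNorm_le_of_integral_rpow_le (by linarith) (hW.memLp n).1
      (integrable_abs_rpow (hW.memLp n) (hW.bounded n) hqt.le) (by positivity) hbound).trans
      (ENNReal.ofReal_le_ofReal ?_)
    refine mul_le_mul_of_nonneg_left (Real.exp_le_exp.2 ?_) (by linarith)
    linarith

/-- The hypercontractive estimate for mild solutions. -/
theorem IsMildSolution.eLpNorm_le (hJ : IsLevyKernel J) (h : IsExponent D p T q)
    (hp : 2 ≤ p) (hC : LocallyIntegrableOn C (Ici p) volume) (hD : ContinuousOn D (Ici p))
    (hLS : ∀ r, p ≤ r → LogSobolev J r (C r) (D r))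
    {v : ℝ → Lp ℝ 2 (volume : Measure (Space N))} (hv : IsMildSolution J v)
    (hv0 : MemLp (v 0) (ENNReal.ofReal p) volume) {t : ℝ} (ht0 : 0 < t) (htT : (t : EReal) < T) :
    eLpNorm (v t) (ENNReal.ofReal (q t)) volume ≤
      ENNReal.ofReal (Real.exp (∫ s in (0 : ℝ)..t, C (q s) / D (q s))) *
        eLpNorm (v 0) (ENNReal.ofReal p) volume := by
  have hex := fun n : ℕ => hv.exists_approximation hJ h hp hC hD hLS hv0 ht0 htT
    (Nat.one_div_pos_of_nat : 0 < 1 / ((n : ℝ) + 1))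
  choose w hw1 hw2 hw3 using hex
  set S := (eLpNorm (v 0) (ENNReal.ofReal p) volume).toReal with hS
  set A := ∫ s in (0 : ℝ)..t, C (q s) / D (q s) with hA
  have hη : Tendsto (fun n : ℕ => 1 / ((n : ℝ) + 1)) atTop (𝓝 0) :=
    tendsto_one_div_add_atTop_nhds_zero_nat
  have hlim : Tendsto (fun n => eLpNorm (fun x => w n x - v t x) 2 volume) atTop (𝓝 0) := by
    have := (ENNReal.continuous_ofReal.tendsto 0).comp hη
    rw [ENNReal.ofReal_zero] at this
    exact tendsto_of_tendsto_of_tendsto_of_le_of_le tendsto_const_nhds this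
      (fun _ => bot_le) hw2
  have hc : Tendsto (fun n : ℕ => ENNReal.ofReal ((S + 1 / ((n : ℝ) + 1)) *
      Real.exp (A + 2 * (1 / ((n : ℝ) + 1))))) atTop
      (𝓝 (ENNReal.ofReal ((S + 0) * Real.exp (A + 2 * 0)))) := by
    refine (ENNReal.continuous_ofReal.tendsto _).comp ?_
    exact (tendsto_const_nhds.add hη).mul
      ((Real.continuous_exp.tendsto _).comp (tendsto_const_nhds.add (hη.const_mul 2)))
  refine (eLpNorm_le_of_tendsto_eLpNorm two_ne_zero hw1 (Lp.memLp (v t)).1 hlim hc hw3).trans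
    (le_of_eq ?_)
  rw [add_zero, mul_zero, add_zero, mul_comm, ENNReal.ofReal_mul (Real.exp_pos _).le, hS,
    ENNReal.ofReal_toReal hv0.eLpNorm_ne_top]

/-- The hypercontractive estimate for solutions with data in `L^p`. -/
theorem IsSolution.eLpNorm_le (hJ : IsLevyKernel J) (h : IsExponent D p T q)
    (hp : 2 ≤ p) (hC : LocallyIntegrableOn C (Ici p) volume) (hD : ContinuousOn D (Ici p))
    (hLS : ∀ r, p ≤ r → LogSobolev J r (C r) (D r)) {u₀ : Space N → ℝ} {u : ℝ → Space N → ℝ}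
    (hu : IsSolution J p u₀ u) {t : ℝ} (ht0 : 0 < t) (htT : (t : EReal) < T) :
    eLpNorm (u t) (ENNReal.ofReal (q t)) volume ≤
      ENNReal.ofReal (Real.exp (∫ s in (0 : ℝ)..t, C (q s) / D (q s))) *
        eLpNorm u₀ (ENNReal.ofReal p) volume := by
  obtain ⟨hu₀, hum, v, hv, hv0, hv0lim, hvlim⟩ := hu
  have hp0 : ENNReal.ofReal p ≠ 0 := (ENNReal.ofReal_pos.2 (by linarith)).ne'
  have hp1 : 1 ≤ ENNReal.ofReal p := by
    rw [← ENNReal.ofReal_one]; exact ENNReal.ofReal_le_ofReal (by linarith)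
  set A := ENNReal.ofReal (Real.exp (∫ s in (0 : ℝ)..t, C (q s) / D (q s))) with hA
  -- The triangle inequality bounds each ‖vₙ(0)‖_p by ‖vₙ(0) - u₀‖_p + ‖u₀‖_p, whose limit is
  -- ‖u₀‖_p.
  have hc : Tendsto (fun n => A * (eLpNorm (fun x => v n 0 x - u₀ x) (ENNReal.ofReal p) volume
      + eLpNorm u₀ (ENNReal.ofReal p) volume)) atTop
      (𝓝 (A * (0 + eLpNorm u₀ (ENNReal.ofReal p) volume))) :=
    ENNReal.Tendsto.const_mul (hv0lim.add tendsto_const_nhds) (Or.inr ENNReal.ofReal_ne_top)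
  rw [zero_add] at hc
  refine eLpNorm_le_of_tendsto_eLpNorm hp0 (fun n => (Lp.memLp (v n t)).1) (hum t ht0.le)
    (hvlim t ht0.le) hc fun n => ?_
  refine ((hv n).eLpNorm_le hJ h hp hC hD hLS (hv0 n) ht0 htT).trans (mul_le_mul_right ?_ _)
  have := eLpNorm_add_le ((hv0 n).1.sub hu₀.1) hu₀.1 hp1
  rw [sub_add_cancel] at this
  exact this

end LevyHyper

end

theorem mainTheorem2 {N : ℕ} (J : LevyHyper.Space N → LevyHyper.Space N → ℝ≥0)
    (hJ : LevyHyper.IsLevyKernel J) (p : ℝ) (hp : 2 ≤ p) (C D : ℝ → ℝ)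
    (hC : LocallyIntegrableOn C (Ici p) volume) (hD : ContinuousOn D (Ici p))
    (hLS : ∀ r, p ≤ r → LevyHyper.LogSobolev J r (C r) (D r)) :
    (∃ (T : EReal) (q : ℝ → ℝ), LevyHyper.IsExponent D p T q) ∧
    ∀ (T : EReal) (q : ℝ → ℝ), LevyHyper.IsExponent D p T q →
      LevyHyper.Hypercontractive J p T q
          (fun t => Real.exp (∫ α in p..(q t), C α / α ^ 2)) ∧
        ∀ t ∈ LevyHyper.timeInterval T,
          IntervalIntegrable (fun s => C (q s) / D (q s)) volume 0 t ∧
          IntervalIntegrable (fun α => C α / α ^ 2) volume p (q t) ∧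
          Real.exp (∫ s in (0 : ℝ)..t, C (q s) / D (q s))
            = Real.exp (∫ α in p..(q t), C α / α ^ 2) := by
  have hp0 : 0 < p := by linarith
  have hpos : ∀ r, p ≤ r → 0 < D r := fun r hr => (hLS r hr).1
  refine ⟨LevyHyper.exists_isExponent hp0 hD hpos, fun T q h => ⟨?_, fun t ht => ?_⟩⟩
  · refine ⟨h.pos, (h.strictMonoOn hp0 hpos).monotoneOn, h.le, h.initial, h.tendsto,
      fun t _ => (Real.exp_pos _).le, fun u₀ u hu t ht0 htT => ?_⟩
    rw [← (h.change_of_variables hp0 hpos hC ⟨ht0.le, htT⟩).2.2]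
    exact hu.eLpNorm_le hJ h hp hC hD hLS ht0 htT
  · obtain ⟨h1, h2, h3⟩ := h.change_of_variables hp0 hpos hC ht
    exact ⟨h1, h2, by rw [h3]⟩
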